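/- Let $n_1,n_2,n\in\mathbb N$ with $n_1+n_2\le n$, let $\emptyset\ne\mathcal J(i)\subseteq\{1,\dots,n\}$ for $1\le i\le n_1+n_2$, and let $q_k\in\mathbb R^n$, $b_k\in\mathbb R$ for $n_1+n_2<k\le n$. A vector $x\in\mathbb R^n$ is a feasible solution of the associated system of linear equations with min and max operators (LEMM) if $$x_i=\min_{l\in\mathcal J(i)}x_l\ (1\le i\le n_1),\qquad x_j=\max_{l\in\mathcal J(j)}x_l\ (n_1<j\le n_1+n_2),\qquad x_k=q_k^{\mathsf T}x+b_k\ (n_1+n_2<k\le n).$$ For every choice function $\ell$ with $\ell(i)\in\mathcal J(i)$ for $1\le i\le n_1+n_2$, let $Q_\ell$ be the $n\times n$ matrix whose $i$-th row is the unit vector $e_{\ell(i)}^{\mathsf T}$ for $i\le n_1+n_2$ and $q_i^{\mathsf T}$ for $i>n_1+n_2$. The LEMM satisfies condition C1 if $\lim_{m\to\infty}Q^m=0$ for every $Q$ in the convex hull of the matrices $Q_\ell$. The LEMM decision problem under C1 is the following promise problem: given an LEMM with rational data that satisfies C1, an index $i\in\{1,\dots,n\}$ and a rational threshold $\beta$ (rational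 numbers being written in binary), decide whether there is a feasible solution $x$ with $x_i<\beta$. A promise problem is in UP if there is a verifier, running in polynomial time on a Turing machine, which for every instance satisfying the promise accepts exactly one certificate, of length polynomially bounded in the size of the instance, if the answer is Yes, and accepts no certificate if the answer is No; it is in coUP if the problem with the answers Yes and No exchanged is in UP. **Theorem.** Every LEMM satisfying C1 has exactly one feasible solution, and the LEMM decision problem under C1 is in $\mathrm{UP}\cap\mathrm{coUP}$. -/

import Mathlib

open Filter Topology

/-- Data `(n₁, n₂, n, J, q, b)` of a system of linear equations with min and max operators, with
coefficients in `R`. Variables are indexed from `0`: those with index `< n₁` are the min variables,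
those with index in `[n₁, n₁ + n₂)` the max variables, the remaining ones the affine variables.
`J` is given for min and max variables only, `q` and `b` for affine variables only. -/
structure LEMM (R : Type) where
  n₁ : ℕ
  n₂ : ℕ
  n : ℕ
  le_n : n₁ + n₂ ≤ n
  J : ∀ i : Fin n, (i : ℕ) < n₁ + n₂ → Finset (Fin n)
  J_nonempty : ∀ i h, (J i h).Nonempty
  q : ∀ k : Fin n, n₁ + n₂ ≤ (k : ℕ) → Fin n → R
  b : ∀ k : Fin n, n₁ + n₂ ≤ (k : ℕ) → R

namespace LEMM

/-- A rational system, regarded as a real one. -/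
noncomputable def toReal (L : LEMM ℚ) : LEMM ℝ where
  n₁ := L.n₁
  n₂ := L.n₂
  n := L.n
  le_n := L.le_n
  J := L.J
  J_nonempty := L.J_nonempty
  q := fun k h l => (L.q k h l : ℝ)
  b := fun k h => (L.b k h : ℝ)

/-- `x` is a feasible solution of the system. -/
def IsFeasible (L : LEMM ℝ) (x : Fin L.n → ℝ) : Prop :=
  (∀ (i : Fin L.n) (h : (i : ℕ) < L.n₁),
    x i = (L.J i (Nat.lt_add_right L.n₂ h)).inf' (L.J_nonempty i _) x) ∧
  (∀ (j : Fin L.n) (_ : L.n₁ ≤ (j : ℕ)) (h : (j : ℕ) < L.n₁ + L.n₂),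
    x j = (L.J j h).sup' (L.J_nonempty j h) x) ∧
  (∀ (k : Fin L.n) (h : L.n₁ + L.n₂ ≤ (k : ℕ)),
    x k = ∑ l, L.q k h l * x l + L.b k h)

/-- The matrix of the linear system obtained by replacing the equation of every min or max
variable `x i` by `x i = x (ℓ i)`. -/
def choiceMatrix (L : LEMM ℝ) (ℓ : ∀ i : Fin L.n, (i : ℕ) < L.n₁ + L.n₂ → Fin L.n) :
    Matrix (Fin L.n) (Fin L.n) ℝ :=
  Matrix.of fun i j =>
    if h : (i : ℕ) < L.n₁ + L.n₂ then (if j = ℓ i h then 1 else 0)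
    else L.q i (not_lt.mp h) j

/-- The set of all matrices obtained from a choice `ℓ i ∈ J i` for each min or max variable. -/
def choiceMatrices (L : LEMM ℝ) : Set (Matrix (Fin L.n) (Fin L.n) ℝ) :=
  {Q | ∃ ℓ : ∀ i : Fin L.n, (i : ℕ) < L.n₁ + L.n₂ → Fin L.n,
    (∀ i h, ℓ i h ∈ L.J i h) ∧ Q = L.choiceMatrix ℓ}

/-- The halting (stability) condition C1. -/
def Halting (L : LEMM ℝ) : Prop :=
  ∀ Q ∈ convexHull ℝ L.choiceMatrices, Tendsto (fun m : ℕ => Q ^ m) atTop (𝓝 0)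

end LEMM

/-- An input of the LEMM decision problem: a rational system, an index, a rational threshold. -/
structure LEMMInstance where
  L : LEMM ℚ
  i : Fin L.n
  β : ℚ

/-- The finite alphabet in which inputs and certificates are written. -/
inductive LEMMSymbol
  | bit (value : Bool)
  | minus
  | slash
  | sep

namespace LEMMInstance

open LEMMSymbol

/-- Unary notation, used for `n₁`, `n₂`, `n` and the index `i` only: all are at most `n`, and the
`n` equations are listed one by one anyway. -/
def encodeUnary (m : ℕ) : List LEMMSymbol :=
  List.replicate m (bit true) ++ [sep]

/-- A rational number in lowest terms: sign, numerator and denominator in binary, least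
significant bit first. -/
def encodeRat (r : ℚ) : List LEMMSymbol :=
  (if r < 0 then [minus] else []) ++ r.num.natAbs.bits.map bit ++ [slash] ++
    r.den.bits.map bit ++ [sep]

/-- The equation number `r`: the membership bits of `J r` for a min or max variable, the
coefficients `q r` followed by `b r` for an affine variable. -/
def encodeRow (L : LEMM ℚ) (r : Fin L.n) : List LEMMSymbol :=
  if h : (r : ℕ) < L.n₁ + L.n₂ then
    ((List.finRange L.n).map fun l => bit (decide (l ∈ L.J r h))) ++ [sep]
  else
    ((List.finRange L.n).flatMap fun l => encodeRat (L.q r (not_lt.mp h) l)) ++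
      encodeRat (L.b r (not_lt.mp h))

/-- The input string of the decision problem. -/
def encode (I : LEMMInstance) : List LEMMSymbol :=
  encodeUnary I.L.n₁ ++ encodeUnary I.L.n₂ ++ encodeUnary I.L.n ++ encodeUnary I.i ++
    encodeRat I.β ++ (List.finRange I.L.n).flatMap (encodeRow I.L)

end LEMMInstance

/-- A decision problem restricted to the instances that satisfy a promise. -/
structure PromiseProblem where
  Inst : Type
  Alphabet : Type
  encode : Inst → List Alphabet
  promise : Inst → Prop
  yes : Inst → Prop

namespace PromiseProblem

/-- The problem with the answers Yes and No exchanged (and the same promise). -/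
def compl (P : PromiseProblem) : PromiseProblem where
  Inst := P.Inst
  Alphabet := P.Alphabet
  encode := P.encode
  promise := P.promise
  yes := fun I => ¬ P.yes I

/-- An instance and a certificate, written one after the other with a separating symbol `none`. -/
def encodePair (P : PromiseProblem) (a : P.Inst × List P.Alphabet) : List (Option P.Alphabet) :=
  (P.encode a.1).map some ++ none :: a.2.map some

/-- The class UP: there is a verifier `V`, computed by a Turing machine in polynomial time, such
that on the instances satisfying the promise, `V` accepts exactly one certificate, of polynomially
bounded length, if the answer is Yes, and no certificate if the answer is No. -/
def InUP (P : PromiseProblem) : Prop :=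
  ∃ (V : P.Inst × List P.Alphabet → Bool) (p : Polynomial ℕ),
    Nonempty (Turing.TM2ComputableInPolyTime P.encodePair Computability.encodeBool V) ∧
    ∀ I : P.Inst, P.promise I →
      (P.yes I → ∃ w : List P.Alphabet, w.length ≤ p.eval (P.encode I).length ∧
        ∀ w', V (I, w') = true ↔ w' = w) ∧
      (¬ P.yes I → ∀ w, V (I, w) = false)

/-- The class coUP. -/
def InCoUP (P : PromiseProblem) : Prop :=
  P.compl.InUP

end PromiseProblem

/-- The LEMM decision problem under condition C1: given a rational system satisfying C1, an index
`i` and a rational threshold `β`, is there a feasible solution `x` with `x i < β`? -/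
def lemmHaltingProblem : PromiseProblem where
  Inst := LEMMInstance
  Alphabet := LEMMSymbol
  encode := LEMMInstance.encode
  promise := fun I => I.L.toReal.Halting
  yes := fun I => ∃ x : Fin I.L.n → ℝ, I.L.toReal.IsFeasible x ∧ x I.i < (I.β : ℝ)

/-!
The feasible solutions are the fixed points of the map `F` of right-hand sides. Row by row,
`F x - F y = Q (x - y)` with `Q` in the convex hull of the choice matrices. This hull is compact
and, by C1, contains no matrix with a real eigenvalue `≥ 1`, so that the maps `x ↦ x - t F x` with
`t ∈ [0, 1]` have a common antilipschitz constant. For `t = 0` the map is the identity, and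
surjectivity can be continued up to `t = 1`: there is exactly one fixed point.

The fixed point solves the linear system of one choice matrix. Cramer's rule and a bound for
determinants show that the solution of a rational system has polynomially many digits, so it can be
its own certificate: the verifier checks the equations and compares one component with the
threshold. For the certificate to be unique, each component has to be written in lowest terms.
Coprimality is certified by a normalized Bézout relation, whose verification takes only
multiplications.

Polynomial running times are derived from closure properties: programs with loops over stacks
compile to Turing machines, and the functions that such programs compute in polynomial time on data
encoded as binary trees are closed under composition, case distinctions and bounded folds.
-/

/-- Structured programs acting on stacks, where the stack `k` holds symbols from `Γ k`. They serve
as a language in which Turing machines with several stacks are composed. -/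
inductive StackProg {K : Type} (Γ : K → Type)
  | skip
  | push (k : K) (a : Γ k)
  | seq (c d : StackProg Γ)
  | popCase (k : K) (f : Option (Γ k) → StackProg Γ)
  | loop (k : K) (p : Option (Γ k) → Bool) (c : StackProg Γ)

namespace StackProg

open Function (update)
open Turing StateTransition

variable {K : Type} {Γ : K → Type}

/-- `Runs c n S S'`: the program `c` transforms the stacks `S` into `S'` in time at most `n`. -/
inductive Runs [DecidableEq K] :
    StackProg Γ → ℕ → (∀ k, List (Γ k)) → (∀ k, List (Γ k)) → Prop
  | skip (S) : Runs skip 1 S S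
  | push (k a S) : Runs (push k a) 1 S (update S k (a :: S k))
  | seq {c d m n S₁ S₂ S₃} : Runs c m S₁ S₂ → Runs d n S₂ S₃ → Runs (seq c d) (m + n) S₁ S₃
  | popCase {k f n S S'} : Runs (f (S k).head?) n (update S k (S k).tail) S' →
      Runs (popCase k f) (n + 1) S S'
  | loop_done {k p c S} : p (S k).head? = false → Runs (loop k p c) 1 S S
  | loop_step {k p c m n S₁ S₂ S₃} : p (S₁ k).head? = true → Runs c m S₁ S₂ →
      Runs (loop k p c) n S₂ S₃ → Runs (loop k p c) (m + n + 1) S₁ S₃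
  | mono {c m n S S'} : Runs c m S S' → m ≤ n → Runs c n S S'

theorem Runs.loop_foldl [DecidableEq K] {α β : Type} {k : K} {p : Option (Γ k) → Bool}
    {c : StackProg Γ} {m : ℕ} (T : β → List α → ∀ k, List (Γ k)) (g : β → α → β)
    (hdone : ∀ b, p (T b [] k).head? = false) (htest : ∀ b a u, p (T b (a :: u) k).head? = true)
    (hstep : ∀ b a u, Runs c m (T b (a :: u)) (T (g b a) u)) (b : β) (u : List α) :
    Runs (loop k p c) ((m + 1) * u.length + 1) (T b u) (T (u.foldl g b) []) := by
  induction u generalizing b with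
  | nil => exact (loop_done (hdone b)).mono (by simp)
  | cons a u ih =>
    exact (loop_step (htest b a u) (hstep b a u) (ih (g b a))).mono
      (by rw [List.length_cons]; lia)

theorem Runs.length_le [DecidableEq K] {c : StackProg Γ} {n : ℕ} {S S' : ∀ k, List (Γ k)}
    (h : Runs c n S S') (k : K) : (S' k).length ≤ (S k).length + n := by
  induction h with
  | skip S => exact Nat.le_succ _
  | push j a S =>
    obtain rfl | hkj := eq_or_ne k j
    · rw [Function.update_self, List.length_cons]
    · rw [Function.update_of_ne hkj]
      exact Nat.le_succ _
  | seq _ _ hc hd => lia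
  | @popCase j f n S S' _ ih =>
    refine ih.trans (Nat.add_le_add ?_ (Nat.le_succ n))
    obtain rfl | hkj := eq_or_ne k j
    · rw [Function.update_self, List.length_tail]
      exact Nat.sub_le _ _
    · rw [Function.update_of_ne hkj]
  | loop_done => exact Nat.le_succ _
  | loop_step _ _ _ hc hl => lia
  | mono _ hmn ih => lia

/-- The positions in a program, used as labels of the machine that executes it. -/
def Label : StackProg Γ → Type
  | skip => Unit
  | push _ _ => Unit
  | seq c d => Label c ⊕ Label d
  | popCase _ f => Option (Σ o, Label (f o))
  | loop _ _ c => Option (Label c)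

theorem finite_label [∀ k, Finite (Γ k)] (c : StackProg Γ) : Finite c.Label := by
  induction c with
  | skip => exact inferInstanceAs (Finite Unit)
  | push => exact inferInstanceAs (Finite Unit)
  | seq c d hc hd => exact inferInstanceAs (Finite (Label c ⊕ Label d))
  | popCase k f hf => exact inferInstanceAs (Finite (Option (Σ o, Label (f o))))
  | loop k p c hc => exact inferInstanceAs (Finite (Option (Label c)))

/-- The position at which the execution of a program starts. -/
def entry : (c : StackProg Γ) → c.Label
  | skip => ()
  | push _ _ => ()
  | seq c _ => Sum.inl c.entry
  | popCase _ _ => none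
  | loop _ _ _ => none

/-- The machine code of a program, where `emb` places the positions of the program among the labels
of the machine, and `exit` is the label to jump to after the execution. The internal state of the
machine records, for every stack, the outcome of the last attempt to read from it. -/
def compile [DecidableEq K] {Λ : Type} : (c : StackProg Γ) → (c.Label → Λ) → Λ → c.Label →
    TM2.Stmt Γ Λ (∀ k, Option (Γ k))
  | skip, _, exit, _ => .goto fun _ => exit
  | push k a, _, exit, _ => .push k (fun _ => a) (.goto fun _ => exit)
  | seq c d, emb, exit, l => match l with
    | Sum.inl l => c.compile (fun l => emb (Sum.inl l)) (emb (Sum.inr d.entry)) l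
    | Sum.inr l => d.compile (fun l => emb (Sum.inr l)) exit l
  | popCase k f, emb, exit, l => match l with
    | none => .pop k (update · k ·) (.goto fun v => emb (some ⟨v k, (f (v k)).entry⟩))
    | some ⟨o, l⟩ => (f o).compile (fun l => emb (some ⟨o, l⟩)) exit l
  | loop k p c, emb, exit, l => match l with
    | none => .peek k (update · k ·)
        (.branch (fun v => p (v k)) (.goto fun _ => emb (some c.entry)) (.goto fun _ => exit))
    | some l => c.compile (fun l => emb (some l)) (emb none) l

theorem nonempty_evalsToInTime_one {σ : Type*} {f : σ → Option σ} {a b : σ} (h : f a = some b) :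
    Nonempty (EvalsToInTime f a (some b) 1) :=
  ⟨⟨⟨1, h⟩, le_rfl⟩⟩

theorem nonempty_evalsToInTime_trans {σ : Type*} {f : σ → Option σ} {m n : ℕ} {a b : σ}
    {c : Option σ} (h₁ : Nonempty (EvalsToInTime f a (some b) m))
    (h₂ : Nonempty (EvalsToInTime f b c n)) : Nonempty (EvalsToInTime f a c (m + n)) :=
  h₁.elim fun h₁ => h₂.elim fun h₂ => ⟨add_comm n m ▸ h₁.trans f m n a b c h₂⟩

theorem Runs.evalsToInTime_compile [DecidableEq K] {c : StackProg Γ} {n : ℕ}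
    {S S' : ∀ k, List (Γ k)} (h : Runs c n S S') {Λ : Type}
    (M : Λ → TM2.Stmt Γ Λ (∀ k, Option (Γ k))) (emb : c.Label → Λ) (exit : Λ)
    (hM : ∀ l, M (emb l) = c.compile emb exit l) (v : ∀ k, Option (Γ k)) :
    ∃ v', Nonempty (EvalsToInTime (TM2.step M) ⟨some (emb c.entry), v, S⟩
      (some ⟨some exit, v', S'⟩) n) := by
  induction h generalizing exit v with
  | skip S => exact ⟨v, nonempty_evalsToInTime_one (by simp only [TM2.step, hM]; rfl)⟩
  | push k a S => exact ⟨v, nonempty_evalsToInTime_one (by simp only [TM2.step, hM]; rfl)⟩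
  | @seq c d _ _ _ _ _ _ _ hc hd =>
    obtain ⟨v₁, h₁⟩ := hc (fun l => emb (Sum.inl l)) (emb (Sum.inr d.entry))
      (fun l => hM (Sum.inl l)) v
    obtain ⟨v₂, h₂⟩ := hd (fun l => emb (Sum.inr l)) exit (fun l => hM (Sum.inr l)) v₁
    exact ⟨v₂, nonempty_evalsToInTime_trans h₁ h₂⟩
  | @popCase k f n S _ _ hf =>
    obtain ⟨v', h'⟩ := hf (fun l => emb (some ⟨(S k).head?, l⟩)) exit
      (fun l => hM (some ⟨_, l⟩)) (update v k (S k).head?)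
    refine ⟨v', add_comm n 1 ▸ nonempty_evalsToInTime_trans (nonempty_evalsToInTime_one ?_) h'⟩
    simp only [TM2.step, hM]
    simp only [compile, entry, TM2.stepAux]
    rw [Function.update_self]
  | @loop_done k p c S hp =>
    refine ⟨update v k (S k).head?, nonempty_evalsToInTime_one ?_⟩
    simp only [TM2.step, hM]
    simp only [compile, entry, TM2.stepAux, Function.update_self, hp, cond_false]
  | @loop_step k p c m n S₁ S₂ S₃ hp _ _ hc hl =>
    obtain ⟨v₁, h₁⟩ := hc (fun l => emb (some l)) (emb none) (fun l => hM (some l))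
      (update v k (S₁ k).head?)
    obtain ⟨v₂, h₂⟩ := hl emb exit hM v₁
    refine ⟨v₂, add_comm (m + n) 1 ▸ nonempty_evalsToInTime_trans (nonempty_evalsToInTime_one ?_)
      (nonempty_evalsToInTime_trans h₁ h₂)⟩
    simp only [TM2.step, hM]
    simp only [compile, entry, TM2.stepAux, Function.update_self, hp, cond_true]
  | mono _ hmn ih =>
    obtain ⟨v', ⟨h'⟩⟩ := ih emb exit hM v
    exact ⟨v', ⟨⟨h'.toEvalsTo, h'.steps_le_m.trans hmn⟩⟩⟩

variable [DecidableEq K]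

/-- The stacks of a machine all of whose stacks but one are empty. -/
def singleStack (k : K) (l : List (Γ k)) : ∀ k, List (Γ k) := update (fun _ => []) k l

theorem dite_eq_singleStack (k₀ : K) (l : List (Γ k₀)) :
    (fun k => if h : k = k₀ then Eq.mpr (congrArg (fun j => List (Γ j)) h) l else []) =
      singleStack k₀ l := by
  funext k
  obtain rfl | hk := eq_or_ne k k₀
  · rw [dif_pos rfl, singleStack, Function.update_self]
    rfl
  · rw [dif_neg hk, singleStack, Function.update_of_ne hk]

/-- The machine executing a program, with input stack `k₀` and output stack `k₁`. -/
noncomputable def toFinTM2 [Finite K] [∀ k, Finite (Γ k)] (c : StackProg Γ) (k₀ k₁ : K) :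
    FinTM2 where
  K := K
  k₀ := k₀
  k₁ := k₁
  Γ := Γ
  Λ := Option c.Label
  main := some c.entry
  kFin := Fintype.ofFinite K
  Γk₀Fin := Fintype.ofFinite (Γ k₀)
  ΛFin := have := c.finite_label; Fintype.ofFinite _
  σFin := Fintype.ofFinite _
  σ := ∀ k, Option (Γ k)
  initialState := fun _ => none
  m
    | none => .load (fun _ _ => none) .halt
    | some l => c.compile some none l

theorem initList_toFinTM2 [Finite K] [∀ k, Finite (Γ k)] (c : StackProg Γ) (k₀ k₁ : K)
    (l : List (Γ k₀)) :
    initList (c.toFinTM2 k₀ k₁) l = ⟨some (some c.entry), fun _ => none, singleStack k₀ l⟩ :=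
  congrArg (TM2.Cfg.mk _ _) (dite_eq_singleStack k₀ l)

theorem haltList_toFinTM2 [Finite K] [∀ k, Finite (Γ k)] (c : StackProg Γ) (k₀ k₁ : K)
    (l : List (Γ k₁)) :
    haltList (c.toFinTM2 k₀ k₁) l = ⟨none, fun _ => none, singleStack k₁ l⟩ :=
  congrArg (TM2.Cfg.mk _ _) (dite_eq_singleStack k₁ l)

theorem nonempty_tm2ComputableInPolyTime [Finite K] [∀ k, Finite (Γ k)] {k₀ k₁ : K}
    {α β : Type} {ea : α → List (Γ k₀)} {eb : β → List (Γ k₁)} {f : α → β} (c : StackProg Γ)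
    (p : Polynomial ℕ) (hc : ∀ a, Runs c (p.eval (ea a).length) (singleStack k₀ (ea a))
      (singleStack k₁ (eb (f a)))) :
    Nonempty (TM2ComputableInPolyTime ea eb f) := by
  refine ⟨{ tm := c.toFinTM2 k₀ k₁
            inputAlphabet := Equiv.refl _
            outputAlphabet := Equiv.refl _
            time := p + 1
            outputsFun := fun a => Classical.choice ?_ }⟩
  obtain ⟨v, hv⟩ := (hc a).evalsToInTime_compile (c.toFinTM2 k₀ k₁).m some none (fun _ => rfl)
    fun _ => none
  have hhalt : TM2.step (c.toFinTM2 k₀ k₁).m ⟨some none, v, singleStack k₁ (eb (f a))⟩ =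
      some ⟨none, fun _ => none, singleStack k₁ (eb (f a))⟩ := rfl
  have h := nonempty_evalsToInTime_trans hv (nonempty_evalsToInTime_one hhalt)
  have hin : (ea a).map (Equiv.refl (Γ k₀)).invFun = ea a := List.map_id _
  have hout : (eb (f a)).map (Equiv.refl (Γ k₁)).invFun = eb (f a) := List.map_id _
  refine cast ?_ h
  rw [TM2OutputsInTime, Option.map_some, Polynomial.eval_add, Polynomial.eval_one]
  erw [hin, hout, haltList_toFinTM2, initList_toFinTM2 c k₀ k₁]
  rfl

/-- The stacks of a machine with work stacks indexed by `K`, a separate input stack and a separate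
output stack. -/
inductive IOStack (K : Type)
  | input
  | work (k : K)
  | output
  deriving DecidableEq, Fintype

/-- The stack alphabets of a machine with input alphabet `A` and output alphabet `B`. -/
def IOStack.Sym (A B : Type) (Γ : K → Type) : IOStack K → Type
  | input => A
  | work k => Γ k
  | output => B

variable {A B : Type}

instance [Finite A] [Finite B] [∀ k, Finite (Γ k)] : ∀ k, Finite (IOStack.Sym A B Γ k)
  | .input => inferInstanceAs (Finite A)
  | .work k => inferInstanceAs (Finite (Γ k))
  | .output => inferInstanceAs (Finite B)

/-- The stacks with given contents of the input stack, the work stacks and the output stack. -/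
def ioStacks (x : List A) (S : ∀ k, List (Γ k)) (y : List B) :
    ∀ k, List (IOStack.Sym A B Γ k)
  | .input => x
  | .work k => S k
  | .output => y

theorem update_ioStacks_input (x x' : List A) (S : ∀ k, List (Γ k)) (y : List B) :
    update (ioStacks x S y) .input x' = ioStacks x' S y := by
  funext k
  cases k <;> rfl

theorem update_ioStacks_output (x : List A) (S : ∀ k, List (Γ k)) (y y' : List B) :
    update (ioStacks x S y) .output y' = ioStacks x S y' := by
  funext k
  cases k <;> rfl

theorem update_ioStacks_work (x : List A) (S : ∀ k, List (Γ k)) (y : List B) (k : K)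
    (l : List (Γ k)) :
    update (ioStacks x S y) (.work k) l = ioStacks x (update S k l) y := by
  funext j
  rcases j with _ | j | _
  · rfl
  · obtain rfl | hjk := eq_or_ne j k
    · exact (Function.update_self _ _ _).trans (Function.update_self j l S).symm
    · exact (Function.update_of_ne (fun h => hjk (IOStack.work.inj h)) _ _).trans
        (Function.update_of_ne hjk l S : update S k l j = S j).symm
  · rfl

/-- A program run on the work stacks of a machine with input and output. -/
def lift : StackProg Γ → StackProg (IOStack.Sym A B Γ)
  | skip => skip
  | push k a => push (.work k) a
  | seq c d => seq c.lift d.lift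
  | popCase k f => popCase (.work k) fun o => (f o).lift
  | loop k p c => loop (.work k) p c.lift

theorem Runs.lift {c : StackProg Γ} {n : ℕ} {S S' : ∀ k, List (Γ k)} (h : Runs c n S S')
    (x : List A) (y : List B) :
    Runs c.lift n (ioStacks x S y) (ioStacks x S' y) := by
  induction h with
  | skip S => exact .skip _
  | push k a S =>
    rw [← update_ioStacks_work]
    exact Runs.push (Γ := IOStack.Sym A B Γ) (.work k) a (ioStacks x S y)
  | seq _ _ hc hd => exact hc.seq hd
  | @popCase k f n S S' _ ih =>
    rw [← update_ioStacks_work] at ih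
    exact .popCase ih
  | loop_done hp => exact .loop_done hp
  | loop_step hp _ _ hc hl => exact .loop_step hp hc hl
  | mono _ hmn ih => exact ih.mono hmn

end StackProg

/-! ### Programs on binary trees -/

/-- The stacks of a program on binary trees: the values the program works on are kept on `data`,
while `save` and `scratch` hold values that are set aside. -/
inductive WorkStack
  | data
  | save
  | scratch
  deriving DecidableEq

instance : Fintype WorkStack := ⟨{.data, .save, .scratch}, fun k => by cases k <;> decide⟩

/-- The alphabets of the work stacks. The symbol `none` of the auxiliary stacks is a delimiter. -/
def WorkStack.Sym : WorkStack → Type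
  | data => Bool
  | save => Option Bool
  | scratch => Option Bool

instance : ∀ k, Finite (WorkStack.Sym k)
  | .data => inferInstanceAs (Finite Bool)
  | .save => inferInstanceAs (Finite (Option Bool))
  | .scratch => inferInstanceAs (Finite (Option Bool))

/-- Programs acting on the work stacks. Values are represented by binary trees, which are written on
the stack `data` in Polish notation. -/
abbrev TreeProg := StackProg WorkStack.Sym

namespace TreeProg

open StackProg
open Function (update)

/-- The work stacks with given contents. -/
def workStacks (r : List Bool) (b c : List (Option Bool)) : ∀ k, List (WorkStack.Sym k)
  | .data => r
  | .save => b
  | .scratch => c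

theorem update_workStacks_data (r r' : List Bool) (b c : List (Option Bool)) :
    update (workStacks r b c) .data r' = workStacks r' b c := by
  funext k
  cases k <;> rfl

theorem update_workStacks_save (r : List Bool) (b b' c : List (Option Bool)) :
    update (workStacks r b c) .save b' = workStacks r b' c := by
  funext k
  cases k <;> rfl

theorem update_workStacks_scratch (r : List Bool) (b c c' : List (Option Bool)) :
    update (workStacks r b c) .scratch c' = workStacks r b c' := by
  funext k
  cases k <;> rfl

theorem runs_push_data (a : Bool) (r : List Bool) (b c : List (Option Bool)) :
    Runs (push .data a : TreeProg) 1 (workStacks r b c) (workStacks (a :: r) b c) :=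
  update_workStacks_data r (a :: r) b c ▸ Runs.push (Γ := WorkStack.Sym) .data a (workStacks r b c)

theorem runs_push_save (a : Option Bool) (r : List Bool) (b c : List (Option Bool)) :
    Runs (push .save a : TreeProg) 1 (workStacks r b c) (workStacks r (a :: b) c) :=
  update_workStacks_save r b (a :: b) c ▸ Runs.push (Γ := WorkStack.Sym) .save a (workStacks r b c)

theorem runs_push_scratch (a : Option Bool) (r : List Bool) (b c : List (Option Bool)) :
    Runs (push .scratch a : TreeProg) 1 (workStacks r b c) (workStacks r b (a :: c)) :=
  update_workStacks_scratch r b c (a :: c) ▸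
    Runs.push (Γ := WorkStack.Sym) .scratch a (workStacks r b c)

variable {n : ℕ} {S' : ∀ k, List (WorkStack.Sym k)}

theorem runs_popCase_data {f : Option Bool → TreeProg} {a : Bool} {r : List Bool}
    {b c : List (Option Bool)} (h : Runs (f (some a)) n (workStacks r b c) S') :
    Runs (popCase .data f : TreeProg) (n + 1) (workStacks (a :: r) b c) S' :=
  .popCase ((update_workStacks_data (a :: r) r b c).symm ▸ h)

theorem runs_popCase_save {f : Option (Option Bool) → TreeProg} {a : Option Bool} {r : List Bool}
    {b c : List (Option Bool)} (h : Runs (f (some a)) n (workStacks r b c) S') :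
    Runs (popCase .save f : TreeProg) (n + 1) (workStacks r (a :: b) c) S' :=
  .popCase ((update_workStacks_save r (a :: b) b c).symm ▸ h)

theorem runs_popCase_scratch {f : Option (Option Bool) → TreeProg} {a : Option Bool}
    {r : List Bool} {b c : List (Option Bool)} (h : Runs (f (some a)) n (workStacks r b c) S') :
    Runs (popCase .scratch f : TreeProg) (n + 1) (workStacks r b (a :: c)) S' :=
  .popCase ((update_workStacks_scratch r b (a :: c) c).symm ▸ h)

/-- Removes the top symbol of a stack. -/
def pop (k : WorkStack) : TreeProg := popCase k fun _ => skip

theorem runs_pop_data (a : Bool) (r : List Bool) (b c : List (Option Bool)) :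
    Runs (pop .data) 2 (workStacks (a :: r) b c) (workStacks r b c) :=
  runs_popCase_data (.skip _)

theorem runs_pop_save (a : Option Bool) (r : List Bool) (b c : List (Option Bool)) :
    Runs (pop .save) 2 (workStacks r (a :: b) c) (workStacks r b c) :=
  runs_popCase_save (.skip _)

theorem runs_pop_scratch (a : Option Bool) (r : List Bool) (b c : List (Option Bool)) :
    Runs (pop .scratch) 2 (workStacks r b (a :: c)) (workStacks r b c) :=
  runs_popCase_scratch (.skip _)

/-- Pushes a word on the stack `data`. -/
def pushWord : List Bool → TreeProg
  | [] => skip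
  | a :: u => seq (pushWord u) (push .data a)

theorem runs_pushWord (u r : List Bool) (b c : List (Option Bool)) :
    Runs (pushWord u) (u.length + 1) (workStacks r b c) (workStacks (u ++ r) b c) := by
  induction u with
  | nil => exact .skip _
  | cons a u ih => exact ih.seq (runs_push_data a _ b c)

/-- Recognizes the symbols other than the delimiter. -/
def isProper : Option (Option Bool) → Bool
  | some (some _) => true
  | _ => false

/-- Runs `f x` for every symbol `x` above the first delimiter of the stack `save`, and removes these
symbols and the delimiter. -/
def drainSave (f : Bool → TreeProg) : TreeProg :=
  seq (loop .save isProper (popCase .save fun o => (o.elim none id).elim skip f)) (pop .save)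

theorem runs_drainSave {f : Bool → TreeProg} {m : ℕ} {α : Type} (r : α → List Bool)
    (c : α → List (Option Bool)) (g : α → Bool → α)
    (hf : ∀ s x b, Runs (f x) m (workStacks (r s) b (c s)) (workStacks (r (g s x)) b (c (g s x))))
    (s : α) (u : List Bool) (b : List (Option Bool)) :
    Runs (drainSave f) ((m + 2) * u.length + 3) (workStacks (r s) (u.map some ++ none :: b) (c s))
      (workStacks (r (u.foldl g s)) b (c (u.foldl g s))) :=
  (Runs.loop_foldl (m := m + 1) (fun s u => workStacks (r s) (u.map some ++ none :: b) (c s)) g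
    (fun _ => rfl) (fun _ _ _ => rfl)
    (fun s x _ => runs_popCase_save (hf s x _)) s u).seq (runs_pop_save _ _ _ _)

/-- Runs `push .save` for every symbol above the first delimiter of the stack `scratch`, and removes
these symbols and the delimiter. -/
def scratchToSave : TreeProg :=
  seq (loop .scratch isProper (popCase .scratch fun o => o.elim skip fun a => push .save a))
    (pop .scratch)

theorem runs_scratchToSave (u r : List Bool) (b c : List (Option Bool)) :
    Runs scratchToSave (3 * u.length + 3) (workStacks r b (u.map some ++ none :: c))
      (workStacks r (u.reverse.map some ++ b) c) := by
  have h : Runs scratchToSave _ _ _ := (Runs.loop_foldl (m := 2)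
    (fun b u => workStacks r b (u.map some ++ none :: c))
    (fun b x => some x :: b) (fun _ => rfl) (fun _ _ _ => rfl)
    (fun b x _ => runs_popCase_scratch (f := fun o => o.elim skip fun a => push .save a)
      (runs_push_save (some x) r b _)) b u).seq
    (runs_pop_scratch _ _ _ _)
  rwa [List.foldl_flip_cons_eq_append, ← List.map_reverse] at h

/-- The Polish notation of a tree. -/
def treeCode : BinaryTree Unit → List Bool
  | .nil => [false]
  | .node () s t => true :: (treeCode s ++ treeCode t)

/-- Recognizes the symbol of an inner node. -/
def isNode : Option Bool → Bool
  | some true => true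
  | _ => false

/-- The loop of `unload`. Each symbol above the delimiter of the stack `scratch` stands for a
subtree that has yet to be read. -/
def unloadLoop : TreeProg :=
  loop .scratch isProper (popCase .data fun
    | some true => seq (push .save (some true)) (push .scratch (some true))
    | some false => seq (push .save (some false)) (pop .scratch)
    | none => skip)

theorem runs_unloadLoop (t : BinaryTree Unit) (r : List Bool) (b c : List (Option Bool))
    (h : Runs unloadLoop n (workStacks r ((treeCode t).reverse.map some ++ b) c) S') :
    Runs unloadLoop (n + 5 * (treeCode t).length) (workStacks (treeCode t ++ r) b (some true :: c))
      S' := by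
  induction t generalizing r b c n with
  | nil =>
    refine (Runs.loop_step rfl
      (runs_popCase_data (.seq (runs_push_save _ _ _ _) (runs_pop_scratch _ _ _ _))) h).mono ?_
    simp only [treeCode, List.length_singleton]
    lia
  | node _ s t hs ht =>
    simp only [treeCode, List.reverse_cons, List.reverse_append, List.map_append, List.map_cons,
      List.map_nil, List.append_assoc, List.singleton_append] at h
    have hst := hs (treeCode t ++ r) (some true :: b) (some true :: c) (ht r _ c h)
    rw [treeCode, List.cons_append, List.append_assoc]
    refine (Runs.loop_step rfl (runs_popCase_data
      (.seq (runs_push_save _ _ _ _) (runs_push_scratch _ _ _ _))) hst).mono ?_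
    rw [List.length_cons, List.length_append]
    lia

/-- Moves the top tree of the stack `data` to the stack `save`. -/
def unload : TreeProg :=
  seq (push .save none) (seq (push .scratch none) (seq (push .scratch (some true))
    (seq unloadLoop (pop .scratch))))

theorem runs_unload (t : BinaryTree Unit) (r : List Bool) (b c : List (Option Bool)) :
    Runs unload (5 * (treeCode t).length + 6) (workStacks (treeCode t ++ r) b c)
      (workStacks r ((treeCode t).reverse.map some ++ none :: b) c) :=
  ((runs_push_save _ _ _ _).seq ((runs_push_scratch _ _ _ _).seq ((runs_push_scratch _ _ _ _).seq
    ((runs_unloadLoop t r (none :: b) (none :: c) (.loop_done rfl)).seq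
      (runs_pop_scratch _ _ _ _))))).mono (by lia)

/-- Moves the top tree of the stack `save` to the stack `data`. -/
def reload : TreeProg := drainSave fun a => push .data a

theorem runs_reload (t : BinaryTree Unit) (r : List Bool) (b c : List (Option Bool)) :
    Runs reload (3 * (treeCode t).length + 3)
      (workStacks r ((treeCode t).reverse.map some ++ none :: b) c)
      (workStacks (treeCode t ++ r) b c) := by
  have h := runs_drainSave (fun r => r) (fun _ => c) (fun r x => x :: r)
    (fun r x b => runs_push_data x r b c) r (treeCode t).reverse b
  rwa [List.foldl_reverse, List.foldr_cons_eq_append, List.map_id', List.length_reverse] at h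

/-- Removes the top tree of the stack `data`. -/
def drop : TreeProg := seq unload (drainSave fun _ => skip)

theorem runs_drop (t : BinaryTree Unit) (r : List Bool) (b c : List (Option Bool)) :
    Runs drop (8 * (treeCode t).length + 9) (workStacks (treeCode t ++ r) b c)
      (workStacks r b c) := by
  have h := runs_drainSave (fun _ : Unit => r) (fun _ => c) (fun _ _ => ())
    (fun _ _ b => .skip (workStacks r b c)) () (treeCode t).reverse b
  rw [List.length_reverse] at h
  exact ((runs_unload t r b c).seq h).mono (by lia)

/-- Duplicates the top tree of the stack `data`. -/
def dup : TreeProg :=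
  seq unload (seq (push .scratch none)
    (seq (drainSave fun x => seq (push .data x) (push .scratch (some x)))
      (seq (push .save none) (seq scratchToSave reload))))

theorem runs_dup (t : BinaryTree Unit) (r : List Bool) (b c : List (Option Bool)) :
    Runs dup (15 * (treeCode t).length + 17) (workStacks (treeCode t ++ r) b c)
      (workStacks (treeCode t ++ (treeCode t ++ r)) b c) := by
  have hcopy := runs_drainSave (fun u => u ++ r) (fun u => u.map some ++ none :: c)
    (fun u x => x :: u) (fun u x b => (runs_push_data x _ b _).seq (runs_push_scratch _ _ _ _)) []
    (treeCode t).reverse b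
  rw [List.foldl_reverse, List.foldr_cons_nil, List.length_reverse] at hcopy
  exact ((runs_unload t r b c).seq ((runs_push_scratch _ _ _ _).seq (hcopy.seq
    ((runs_push_save _ _ _ _).seq ((runs_scratchToSave _ _ _ _).seq
      (runs_reload t _ b c)))))).mono (by lia)

end TreeProg

/-! ### Functions computable in polynomial time -/

/-- Types whose elements are represented by binary trees, so that programs can work on them. -/
class TreeEncodable (α : Type) where
  toTree : α → BinaryTree Unit

namespace TreeEncodable

open TreeProg

variable {α β : Type} [TreeEncodable α] [TreeEncodable β]

/-- The word by which an element is represented on the stack `data`. -/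
abbrev code (a : α) : List Bool := treeCode (toTree a)

/-- The size of an element, with respect to which running times are measured. -/
def size (a : α) : ℕ := (code a).length

theorem length_code (a : α) : (code a).length = size a := rfl

instance : TreeEncodable Unit := ⟨fun _ => .nil⟩

/-- Both truth values get the same size, so that the size of a list of truth values is determined by
its length. -/
instance : TreeEncodable Bool :=
  ⟨fun b => bif b then .node () (.node () .nil .nil) .nil else .node () .nil (.node () .nil .nil)⟩

instance : TreeEncodable (α × β) := ⟨fun p => .node () (toTree p.1) (toTree p.2)⟩

instance : TreeEncodable (List α) := ⟨fun l => l.foldr (fun a t => .node () (toTree a) t) .nil⟩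

theorem code_prodMk (a : α) (b : β) : code (a, b) = true :: (code a ++ code b) := rfl

theorem code_nil : code ([] : List α) = [false] := rfl

theorem code_cons (a : α) (l : List α) : code (a :: l) = true :: (code a ++ code l) := rfl

theorem size_prodMk (a : α) (b : β) : size (a, b) = size a + size b + 1 := by
  rw [size, code_prodMk, List.length_cons, List.length_append, length_code, length_code]

theorem size_nil : size ([] : List α) = 1 := rfl

theorem size_cons (a : α) (l : List α) : size (a :: l) = size a + size l + 1 := by
  rw [size, code_cons, List.length_cons, List.length_append, length_code, length_code]

theorem size_bool (b : Bool) : size b = 5 := by cases b <;> rfl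

theorem size_append (l l' : List α) : size (l ++ l') + 1 = size l + size l' := by
  induction l with
  | nil => rw [List.nil_append, size_nil, add_comm]
  | cons a l ih =>
    rw [List.cons_append, size_cons, size_cons]
    lia

theorem length_lt_size (l : List α) : l.length < size l := by
  induction l with
  | nil => exact Nat.one_pos
  | cons a l ih =>
    rw [List.length_cons, size_cons]
    lia

theorem size_cond_le (b : Bool) (x y : α) : size (bif b then x else y) ≤ max (size x) (size y) := by
  cases b
  · exact le_max_right _ _
  · exact le_max_left _ _

theorem size_tail_le (l : List α) : size l.tail ≤ size l := by
  cases l with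
  | nil => exact le_rfl
  | cons a l =>
    rw [List.tail_cons, size_cons]
    lia

end TreeEncodable

open StackProg TreeProg TreeEncodable

theorem eval_le_eval_of_le (p : Polynomial ℕ) {m n : ℕ} (h : m ≤ n) : p.eval m ≤ p.eval n := by
  rw [Polynomial.eval_eq_sum_range, Polynomial.eval_eq_sum_range]
  gcongr

/-- Functions computable in polynomial time, by a program which replaces the argument on top of the
stack `data` by the value. -/
@[fun_prop]
def PolyTime {α β : Type} [TreeEncodable α] [TreeEncodable β] (f : α → β) : Prop :=
  ∃ (c : TreeProg) (p : Polynomial ℕ), ∀ a r b c', Runs c (p.eval (size a))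
    (workStacks (code a ++ r) b c') (workStacks (code (f a) ++ r) b c')

namespace PolyTime

variable {α β γ σ : Type} [TreeEncodable α] [TreeEncodable β] [TreeEncodable γ] [TreeEncodable σ]

theorem size_le {f : α → β} (hf : PolyTime f) :
    ∃ p : Polynomial ℕ, ∀ a, size (f a) ≤ p.eval (size a) := by
  obtain ⟨c, p, hf⟩ := hf
  refine ⟨.X + p, fun a => ?_⟩
  have h : (code (f a) ++ []).length ≤ (code a ++ []).length + p.eval (size a) :=
    (hf a [] [] []).length_le .data
  rw [List.append_nil, List.append_nil] at h
  rwa [Polynomial.eval_add, Polynomial.eval_X]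

theorem size_le_add {f : γ → α → β} (hf : PolyTime fun p : γ × α => f p.1 p.2) :
    ∃ p : Polynomial ℕ, ∀ c a, size (f c a) ≤ p.eval (size c + size a) := by
  obtain ⟨p, hp⟩ := hf.size_le
  refine ⟨p.comp (.X + 1), fun c a => (hp (c, a)).trans_eq ?_⟩
  rw [Polynomial.eval_comp, size_prodMk, Polynomial.eval_add, Polynomial.eval_X,
    Polynomial.eval_one]

theorem congr_toTree {f : α → β} {g : α → γ} (hg : PolyTime g)
    (h : ∀ a, toTree (f a) = toTree (g a)) : PolyTime f := by
  obtain ⟨c, p, hg⟩ := hg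
  refine ⟨c, p, fun a r b c' => ?_⟩
  have hcode : code (f a) = code (g a) := congrArg treeCode (h a)
  rw [hcode]
  exact hg a r b c'

protected theorem congr {f g : α → β} (hg : PolyTime g) (h : ∀ a, f a = g a) : PolyTime f :=
  hg.congr_toTree fun a => congrArg toTree (h a)

@[fun_prop]
protected theorem id : PolyTime fun a : α => a :=
  ⟨skip, 1, fun a _ _ _ => Polynomial.eval_one (x := size a) ▸ .skip _⟩

@[fun_prop]
protected theorem comp {g : β → γ} {f : α → β} (hg : PolyTime g) (hf : PolyTime f) :
    PolyTime fun a => g (f a) := by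
  obtain ⟨q', hq'⟩ := hf.size_le
  obtain ⟨c, p, hf⟩ := hf
  obtain ⟨d, q, hg⟩ := hg
  refine ⟨seq c d, p + q.comp q', fun a r b c' => ?_⟩
  rw [Polynomial.eval_add, Polynomial.eval_comp]
  exact (hf a r b c').seq ((hg _ r b c').mono (eval_le_eval_of_le q (hq' a)))

@[fun_prop]
protected theorem const (b : β) : PolyTime fun _ : α => b := by
  refine ⟨seq drop (pushWord (code b)), 8 * .X + Polynomial.C (size b + 10), fun a r b' c' => ?_⟩
  refine ((runs_drop (toTree a) _ _ _).seq (runs_pushWord _ _ _ _)).mono ?_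
  simp only [length_code, Polynomial.eval_add, Polynomial.eval_mul, Polynomial.eval_ofNat,
    Polynomial.eval_X, Polynomial.eval_C]
  lia

theorem prod_snd : PolyTime fun p : α × β => p.2 := by
  refine ⟨seq (pop .data) drop, 8 * .X + 11, fun ⟨x, y⟩ r b c' => ?_⟩
  rw [code_prodMk, List.cons_append, List.append_assoc]
  refine ((runs_pop_data _ _ _ _).seq (runs_drop (toTree x) _ _ _)).mono ?_
  simp only [length_code, size_prodMk, Polynomial.eval_add, Polynomial.eval_mul,
    Polynomial.eval_ofNat, Polynomial.eval_X]
  lia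

theorem prod_fst : PolyTime fun p : α × β => p.1 := by
  refine ⟨seq (pop .data) (seq unload (seq drop reload)), 8 * .X + 20, fun ⟨x, y⟩ r b c' => ?_⟩
  rw [code_prodMk, List.cons_append, List.append_assoc]
  refine ((runs_pop_data _ _ _ _).seq ((runs_unload (toTree x) _ _ _).seq
    ((runs_drop (toTree y) _ _ _).seq (runs_reload _ _ _ _)))).mono ?_
  simp only [length_code, size_prodMk, Polynomial.eval_add, Polynomial.eval_mul,
    Polynomial.eval_ofNat, Polynomial.eval_X]
  lia

@[fun_prop]
protected theorem fst {f : γ → α × β} (hf : PolyTime f) : PolyTime fun x => (f x).1 :=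
  prod_fst.comp hf

@[fun_prop]
protected theorem snd {f : γ → α × β} (hf : PolyTime f) : PolyTime fun x => (f x).2 :=
  prod_snd.comp hf

@[fun_prop]
protected theorem prodMk {f : γ → α} {g : γ → β} (hf : PolyTime f) (hg : PolyTime g) :
    PolyTime fun x => (f x, g x) := by
  obtain ⟨s, hs⟩ := hf.size_le
  obtain ⟨c, p, hf⟩ := hf
  obtain ⟨d, q, hg⟩ := hg
  refine ⟨seq dup (seq c (seq unload (seq d (seq reload (push .data true))))),
    15 * .X + 8 * s + p + q + 27, fun x r b c' => ?_⟩
  rw [code_prodMk, List.cons_append, List.append_assoc]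
  refine ((runs_dup (toTree x) _ _ _).seq ((hf x _ _ _).seq ((runs_unload (toTree (f x)) _ _ _).seq
    ((hg x _ _ _).seq ((runs_reload _ _ _ _).seq (runs_push_data _ _ _ _)))))).mono ?_
  have := hs x
  simp only [length_code, Polynomial.eval_add, Polynomial.eval_mul, Polynomial.eval_ofNat,
    Polynomial.eval_X]
  lia

@[fun_prop]
theorem list_cons {f : γ → α} {l : γ → List α} (hf : PolyTime f) (hl : PolyTime l) :
    PolyTime fun x => f x :: l x :=
  (hf.prodMk hl).congr_toTree fun _ => rfl

theorem list_casesOn_prod {f : γ → β} {g : α × List α × γ → β} (hf : PolyTime f)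
    (hg : PolyTime g) :
    PolyTime fun p : List α × γ =>
      List.casesOn (motive := fun _ => β) p.1 (f p.2) fun a l => g (a, l, p.2) := by
  obtain ⟨c, p, hf⟩ := hf
  obtain ⟨d, q, hg⟩ := hg
  refine ⟨seq (pop .data) (popCase .data fun o => bif isNode o then
    seq unload (seq (push .data true) (seq reload (seq (push .data true) d))) else c),
    p + q + 8 * .X + 20, fun ⟨l, y⟩ r b c' => ?_⟩
  simp only [Polynomial.eval_add, Polynomial.eval_mul, Polynomial.eval_ofNat, Polynomial.eval_X]
  cases l with
  | nil =>
    rw [code_prodMk, code_nil]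
    refine ((runs_pop_data _ _ _ _).seq (runs_popCase_data (hf y r b c'))).mono ?_
    have := eval_le_eval_of_le p (show size y ≤ size (([] : List α), y) by
      rw [size_prodMk]; lia)
    lia
  | cons x l =>
    have hsize : size (x, l, y) = size (x :: l, y) := by
      simp only [size_prodMk, size_cons]
      lia
    have hgx := hg (x, l, y) r b c'
    rw [code_prodMk, code_prodMk, List.cons_append, List.append_assoc, List.cons_append,
      List.append_assoc] at hgx
    have hbranch := (runs_unload (toTree x) (code l ++ (code y ++ r)) b c').seq
      ((runs_push_data _ _ _ _).seq ((runs_reload _ _ _ _).seq ((runs_push_data _ _ _ _).seq hgx)))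
    have hcode : code (x :: l, y) ++ r = true :: true :: (code x ++ (code l ++ (code y ++ r))) := by
      simp only [code_prodMk, code_cons, List.cons_append, List.append_assoc]
    rw [hcode]
    refine ((runs_pop_data _ _ _ _).seq (runs_popCase_data hbranch)).mono ?_
    rw [hsize, size_prodMk, size_cons, length_code]
    lia

theorem list_casesOn {l : γ → List α} {f : γ → β} {g : γ → α → List α → β} (hl : PolyTime l)
    (hf : PolyTime f) (hg : PolyTime fun p : γ × α × List α => g p.1 p.2.1 p.2.2) :
    PolyTime fun x => List.casesOn (motive := fun _ => β) (l x) (f x) (g x) :=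
  (list_casesOn_prod hf (hg.comp (f := fun q : α × List α × γ => (q.2.2, q.1, q.2.1))
    (by fun_prop))).comp (hl.prodMk .id)

@[fun_prop]
theorem headD {l : γ → List α} {d : γ → α} (hl : PolyTime l) (hd : PolyTime d) :
    PolyTime fun x => (l x).headD (d x) :=
  (hl.list_casesOn (g := fun _ a _ => a) hd (by fun_prop)).congr fun x => by cases l x <;> rfl

@[fun_prop]
theorem tail {l : γ → List α} (hl : PolyTime l) : PolyTime fun x => (l x).tail :=
  (hl.list_casesOn (g := fun _ _ l => l) (.const []) (by fun_prop)).congr fun x => by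
    cases l x <;> rfl

@[fun_prop]
theorem isEmpty {l : γ → List α} (hl : PolyTime l) : PolyTime fun x => (l x).isEmpty :=
  (hl.list_casesOn (g := fun _ _ _ => false) (.const true) (by fun_prop)).congr fun x => by
    cases l x <;> rfl

/-- The list of lists of units represented by the same tree as a truth value. -/
def listOfBool (b : Bool) : List (List Unit) := bif b then [[()]] else [[], []]

@[fun_prop]
protected theorem cond {b : γ → Bool} {f g : γ → β} (hb : PolyTime b) (hf : PolyTime f)
    (hg : PolyTime g) : PolyTime fun x => bif b x then f x else g x := by
  have hlist : PolyTime fun x => listOfBool (b x) := hb.congr_toTree fun x => by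
    cases b x <;> rfl
  exact (hlist.tail.list_casesOn (g := fun x _ _ => g x) hf (by fun_prop)).congr fun x => by
    cases b x <;> rfl

section foldl

variable {f : γ → σ → α → σ} {s : γ → σ} {l : γ → List α}

/-- The effect of one pass of the loop that computes a fold. -/
def foldlStep (f : γ → σ → α → σ) (p : List α × σ × γ) : List α × σ × γ :=
  List.casesOn (motive := fun _ => List α × σ × γ) p.1 ([], p.2)
    fun a l => (l, f p.2.2 p.2.1 a, p.2.2)

theorem runs_foldlLoop {d : TreeProg} {q : Polynomial ℕ}
    (hd : ∀ a r b c', Runs d (q.eval (size a)) (workStacks (code a ++ r) b c')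
      (workStacks (code (foldlStep f a) ++ r) b c'))
    (N : ℕ) (c : γ) (l : List α) (s : σ)
    (hN : ∀ l₁ l₂, l = l₁ ++ l₂ → size (l₂, l₁.foldl (f c) s, c) ≤ N) (r : List Bool)
    (b c' : List (Option Bool)) :
    Runs (loop .data isNode (seq (push .data true) (seq d (pop .data))))
      ((q.eval N + 4) * l.length + 1)
      (workStacks (code l ++ (code (s, c) ++ r)) b c')
      (workStacks (code ([] : List α) ++ (code (l.foldl (f c) s, c) ++ r)) b c') := by
  induction l generalizing s with
  | nil => exact .loop_done rfl
  | cons x l ih =>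
    have hrest := ih (f c s x) fun l₁ l₂ h => hN (x :: l₁) l₂ (by rw [h]; rfl)
    have hpass := (hd (x :: l, s, c) r b c').mono (eval_le_eval_of_le q (hN [] (x :: l) rfl))
    have hstep : foldlStep f (x :: l, s, c) = (l, f c s x, c) := rfl
    rw [hstep, code_prodMk, code_prodMk l, List.cons_append, List.append_assoc, List.cons_append,
      List.append_assoc] at hpass
    refine (Runs.loop_step rfl
      ((runs_push_data _ _ _ _).seq (hpass.seq (runs_pop_data _ _ _ _))) hrest).mono ?_
    rw [List.length_cons, Nat.mul_succ]
    lia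

theorem foldl_of_size_le (hf : PolyTime fun p : γ × σ × α => f p.1 p.2.1 p.2.2)
    (hs : PolyTime s) (hl : PolyTime l)
    (h : ∃ p : Polynomial ℕ, ∀ c l₁ l₂, l c = l₁ ++ l₂ →
      size (l₁.foldl (f c) (s c)) ≤ p.eval (size c)) :
    PolyTime fun c => (l c).foldl (f c) (s c) := by
  obtain ⟨t, ht⟩ := h
  have hstep : PolyTime (foldlStep f) :=
    list_casesOn_prod (f := fun q => (([] : List α), q))
      (g := fun q => (q.2.1, f q.2.2.2 q.2.2.1 q.1, q.2.2.2)) (by fun_prop)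
      (.prodMk (by fun_prop) (.prodMk (hf.comp
        (f := fun q : α × List α × σ × γ => (q.2.2.2, q.2.2.1, q.1)) (by fun_prop)) (by fun_prop)))
  obtain ⟨u, hu⟩ := hl.size_le
  obtain ⟨d, q, hd⟩ := hstep
  obtain ⟨e, p, he⟩ := hl.prodMk (hs.prodMk .id)
  suffices h : PolyTime fun c => (([] : List α), (l c).foldl (f c) (s c), c) from h.snd.fst
  refine ⟨seq e (seq (pop .data) (seq (loop .data isNode (seq (push .data true)
    (seq d (pop .data)))) (push .data true))), p + (q.comp (u + t + .X + 2) + 4) * u + 4,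
    fun c r b c' => ?_⟩
  have hloop := runs_foldlLoop hd ((u + t + .X + 2).eval (size c)) c (l c) (s c)
    (fun l₁ l₂ h => ?_) r b c'
  · have hinit := he c r b c'
    rw [code_prodMk, List.cons_append, List.append_assoc] at hinit
    refine (hinit.seq ((runs_pop_data _ _ _ _).seq
      (hloop.seq (runs_push_data _ _ _ _)))).mono ?_
    have := Nat.mul_le_mul_left (q.eval ((u + t + .X + 2).eval (size c)) + 4)
      ((length_lt_size (l c)).le.trans (hu c))
    simp only [Polynomial.eval_add, Polynomial.eval_mul, Polynomial.eval_comp, Polynomial.eval_X,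
      Polynomial.eval_ofNat] at this ⊢
    lia
  · have hl₂ : size l₂ ≤ u.eval (size c) := by
      have := hu c
      rw [h] at this
      have := size_append l₁ l₂
      have := length_lt_size l₁
      lia
    have := ht c l₁ l₂ h
    simp only [size_prodMk, Polynomial.eval_add, Polynomial.eval_X, Polynomial.eval_ofNat]
    lia

theorem foldl_of_measure (hf : PolyTime fun p : γ × σ × α => f p.1 p.2.1 p.2.2)
    (hs : PolyTime s) (hl : PolyTime l) (m : σ → ℕ)
    (hm : ∃ p : Polynomial ℕ, ∀ s, m s ≤ p.eval (size s))
    (hsize : ∃ p : Polynomial ℕ, ∀ s, size s ≤ p.eval (m s))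
    (hstep : ∃ p : Polynomial ℕ, ∀ c s x, m (f c s x) ≤ m s + p.eval (size c + size x)) :
    PolyTime fun c => (l c).foldl (f c) (s c) := by
  obtain ⟨p₁, hm⟩ := hm
  obtain ⟨p₂, hsize⟩ := hsize
  obtain ⟨p₃, hstep⟩ := hstep
  obtain ⟨u, hu⟩ := hs.size_le
  obtain ⟨v, hv⟩ := hl.size_le
  have hfold : ∀ c (l : List α) s,
      m (l.foldl (f c) s) ≤ m s + l.length * p₃.eval (size c + size l) := by
    intro c l
    induction l with
    | nil => simp
    | cons x l ih =>
      intro s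
      have h := ih (f c s x)
      have h' := hstep c s x
      rw [List.foldl_cons, List.length_cons, Nat.succ_mul, size_cons]
      have hx := eval_le_eval_of_le p₃
        (show size c + size x ≤ size c + (size x + size l + 1) by lia)
      have hl := Nat.mul_le_mul_left l.length (eval_le_eval_of_le p₃
        (show size c + size l ≤ size c + (size x + size l + 1) by lia))
      lia
  refine foldl_of_size_le hf hs hl ⟨p₂.comp (p₁.comp u + v * p₃.comp (.X + v)),
    fun c l₁ l₂ h => (hsize _).trans ?_⟩
  have hl₁ : size l₁ ≤ v.eval (size c) := by
    have := hv c
    rw [h] at this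
    have := size_append l₁ l₂
    have := length_lt_size l₂
    lia
  simp only [Polynomial.eval_comp, Polynomial.eval_add, Polynomial.eval_mul, Polynomial.eval_X]
  refine eval_le_eval_of_le p₂ ((hfold c l₁ (s c)).trans (add_le_add ?_ (Nat.mul_le_mul ?_ ?_)))
  · exact (hm _).trans (eval_le_eval_of_le p₁ (hu c))
  · exact (length_lt_size l₁).le.trans hl₁
  · exact eval_le_eval_of_le p₃ (by lia)

theorem foldl (hf : PolyTime fun p : γ × σ × α => f p.1 p.2.1 p.2.2) (hs : PolyTime s)
    (hl : PolyTime l) (hstep : ∃ p : Polynomial ℕ, ∀ c s x,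
      size (f c s x) ≤ size s + p.eval (size c + size x)) :
    PolyTime fun c => (l c).foldl (f c) (s c) :=
  hf.foldl_of_measure hs hl size ⟨.X, fun _ => Polynomial.eval_X.ge⟩
    ⟨.X, fun _ => Polynomial.eval_X.ge⟩ hstep

end foldl

@[fun_prop]
protected theorem and {f g : γ → Bool} (hf : PolyTime f) (hg : PolyTime g) :
    PolyTime fun x => f x && g x :=
  (hf.cond hg (.const false)).congr fun x => (Bool.cond_false_right (f x) (g x)).symm

@[fun_prop]
protected theorem or {f g : γ → Bool} (hf : PolyTime f) (hg : PolyTime g) :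
    PolyTime fun x => f x || g x :=
  (hf.cond (.const true) hg).congr fun x => (Bool.cond_true_left (f x) (g x)).symm

@[fun_prop]
protected theorem not {f : γ → Bool} (hf : PolyTime f) : PolyTime fun x => !f x :=
  (hf.cond (.const false) (.const true)).congr fun x => by cases f x <;> rfl

@[fun_prop]
protected theorem xor {f g : γ → Bool} (hf : PolyTime f) (hg : PolyTime g) :
    PolyTime fun x => f x ^^ g x :=
  (hf.cond hg.not hg).congr fun x => by cases f x <;> cases g x <;> rfl

@[fun_prop]
theorem reverse {l : γ → List α} (hl : PolyTime l) : PolyTime fun x => (l x).reverse := by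
  have : PolyTime fun l : List α => l.foldl (fun acc x => x :: acc) [] :=
    foldl (f := fun _ acc x => x :: acc) (by fun_prop) (.const _) .id ⟨.X + 1, fun c s x => by
      rw [size_cons, Polynomial.eval_add, Polynomial.eval_X, Polynomial.eval_one]
      lia⟩
  exact (this.comp hl).congr fun x => by
    rw [List.foldl_flip_cons_eq_append, List.append_nil, List.map_id']

theorem foldr_of_measure {f : γ → α → σ → σ} {s : γ → σ} {l : γ → List α}
    (hf : PolyTime fun p : γ × σ × α => f p.1 p.2.2 p.2.1) (hs : PolyTime s) (hl : PolyTime l)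
    (m : σ → ℕ) (hm : ∃ p : Polynomial ℕ, ∀ s, m s ≤ p.eval (size s))
    (hsize : ∃ p : Polynomial ℕ, ∀ s, size s ≤ p.eval (m s))
    (hstep : ∃ p : Polynomial ℕ, ∀ c s x, m (f c x s) ≤ m s + p.eval (size c + size x)) :
    PolyTime fun c => (l c).foldr (f c) (s c) :=
  (foldl_of_measure (f := fun c s x => f c x s) hf hs hl.reverse m hm hsize hstep).congr fun _ =>
    List.foldl_reverse.symm

theorem foldr {f : γ → α → σ → σ} {s : γ → σ} {l : γ → List α}
    (hf : PolyTime fun p : γ × σ × α => f p.1 p.2.2 p.2.1) (hs : PolyTime s) (hl : PolyTime l)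
    (hstep : ∃ p : Polynomial ℕ, ∀ c s x,
      size (f c x s) ≤ size s + p.eval (size c + size x)) :
    PolyTime fun c => (l c).foldr (f c) (s c) :=
  (foldl (f := fun c s x => f c x s) hf hs hl.reverse hstep).congr fun _ =>
    List.foldl_reverse.symm

@[fun_prop]
theorem append {l l' : γ → List α} (hl : PolyTime l) (hl' : PolyTime l') :
    PolyTime fun x => l x ++ l' x := by
  have : PolyTime fun p : List α × List α => p.1.foldr (fun x acc => x :: acc) p.2 :=
    foldr (f := fun _ x acc => x :: acc) (by fun_prop) (by fun_prop) (by fun_prop)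
      ⟨.X + 1, fun c s x => by
        rw [size_cons, Polynomial.eval_add, Polynomial.eval_X, Polynomial.eval_one]
        lia⟩
  exact (this.comp (hl.prodMk hl')).congr fun _ => List.foldr_cons_eq_append'.symm

theorem flatMap {f : γ → α → List β} {l : γ → List α}
    (hf : PolyTime fun p : γ × α => f p.1 p.2) (hl : PolyTime l) :
    PolyTime fun c => (l c).flatMap (f c) := by
  obtain ⟨p, hp⟩ := hf.size_le_add
  refine (foldr (f := fun c x acc => f c x ++ acc)
    (.append (hf.comp (f := fun p : γ × List β × α => (p.1, p.2.2)) (by fun_prop)) (by fun_prop))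
    (.const []) hl ⟨p, fun c s x => ?_⟩).congr fun c => ?_
  · have := hp c x
    have := size_append (f c x) s
    lia
  · induction l c with
    | nil => rfl
    | cons x l ih => rw [List.flatMap_cons, ih, List.foldr_cons]

theorem map {f : γ → α → β} {l : γ → List α} (hf : PolyTime fun p : γ × α => f p.1 p.2)
    (hl : PolyTime l) : PolyTime fun c => (l c).map (f c) :=
  (flatMap (f := fun c x => [f c x]) (by fun_prop) hl).congr fun _ => List.map_eq_flatMap

theorem all {f : γ → α → Bool} {l : γ → List α} (hf : PolyTime fun p : γ × α => f p.1 p.2)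
    (hl : PolyTime l) : PolyTime fun c => (l c).all (f c) :=
  (foldr (f := fun c x acc => f c x && acc)
    (.and (hf.comp (f := fun p : γ × Bool × α => (p.1, p.2.2)) (by fun_prop)) (by fun_prop))
    (.const true) hl ⟨0, fun c s x => (size_bool _).trans_le
      ((size_bool s).symm.trans_le (Nat.le_add_right _ _))⟩).congr fun c => by
      induction l c with
      | nil => rfl
      | cons x l ih => rw [List.all_cons, ih, List.foldr_cons]

theorem any {f : γ → α → Bool} {l : γ → List α} (hf : PolyTime fun p : γ × α => f p.1 p.2)
    (hl : PolyTime l) : PolyTime fun c => (l c).any (f c) :=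
  (all (f := fun c x => !f c x) hf.not hl).not.congr fun _ => List.any_eq_not_all_not

/-- The effect of one pass of the loop that computes `List.zip`. -/
def zipStep {ι κ : Type} (s : List κ × List (ι × κ)) (a : ι) : List κ × List (ι × κ) :=
  List.casesOn (motive := fun _ => List κ × List (ι × κ)) s.1 ([], s.2)
    fun b l => (l, (a, b) :: s.2)

theorem foldl_zipStep {ι κ : Type} (l : List ι) (l' : List κ) (acc : List (ι × κ)) :
    (l.foldl zipStep (l', acc)).2 = (l.zip l').reverse ++ acc := by
  induction l generalizing l' acc with
  | nil => rfl
  | cons a l ih =>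
    cases l' with
    | nil => exact (ih [] acc).trans (by rw [List.zip_nil_right, List.zip_nil_right])
    | cons b l' => exact (ih l' ((a, b) :: acc)).trans (by simp)

@[fun_prop]
theorem zip {l : γ → List α} {l' : γ → List β} (hl : PolyTime l) (hl' : PolyTime l') :
    PolyTime fun x => (l x).zip (l' x) := by
  have hstep : PolyTime fun p : γ × (List β × List (α × β)) × α => zipStep p.2.1 p.2.2 :=
    list_casesOn (l := fun p : γ × (List β × List (α × β)) × α => p.2.1.1)
      (f := fun p => (([] : List β), p.2.1.2))
      (g := fun p b l => (l, (p.2.2, b) :: p.2.1.2)) (by fun_prop) (by fun_prop) (by fun_prop)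
  have hfold : PolyTime fun x => (l x).foldl zipStep (l' x, []) := by
    refine foldl (f := fun _ => zipStep) hstep (by fun_prop) hl ⟨.X + 1, fun c s x => ?_⟩
    rw [Polynomial.eval_add, Polynomial.eval_X, Polynomial.eval_one]
    obtain ⟨_ | ⟨b, l⟩, acc⟩ := s
    · exact Nat.le_add_right _ _
    · simp only [zipStep, size_prodMk, size_cons]
      lia
  exact hfold.snd.reverse.congr fun x => by
    rw [foldl_zipStep, List.append_nil, List.reverse_reverse]

theorem drop_length {l : γ → List α} {l' : γ → List β} (hl : PolyTime l) (hl' : PolyTime l') :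
    PolyTime fun x => (l' x).drop (l x).length := by
  refine (foldl (f := fun _ s _ => s.tail) (by fun_prop) hl' hl ⟨0, fun c s x => ?_⟩).congr
    fun x => ?_
  · exact (size_tail_le s).trans (Nat.le_add_right _ _)
  · generalize l' x = k
    induction l x generalizing k with
    | nil => rfl
    | cons a l ih => rw [List.length_cons, List.foldl_cons, ← ih, List.drop_tail]

end PolyTime

/-! ### Arithmetic and strings -/

/-- The symbols on the tape of the verifier: those of the instance and of the certificate, and the
symbol `none` between the two. -/
abbrev Cell : Type := Option LEMMSymbol

namespace Cell

/-- A code for symbols of three bits. -/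
def bits : Cell → Bool × Bool × Bool
  | none => (false, false, false)
  | some (.bit b) => (true, false, b)
  | some .minus => (false, true, false)
  | some .slash => (false, true, true)
  | some .sep => (true, true, true)

theorem bits_injective : Function.Injective bits := by
  rintro (_ | b | _ | _ | _) (_ | b' | _ | _ | _) h <;> simp_all [bits]

end Cell

instance : TreeEncodable Cell := ⟨fun a => toTree a.bits⟩

instance : Finite LEMMSymbol :=
  .of_injective (fun a => Cell.bits (some a)) fun _ _ h =>
    Option.some_inj.mp (Cell.bits_injective h)

instance : DecidableEq LEMMSymbol := fun a b =>
  decidable_of_iff (Cell.bits (some a) = Cell.bits (some b))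
    (Cell.bits_injective.eq_iff.trans (Option.some_inj))

/-- A natural number is represented by the list of its binary digits, the least significant one
first. -/
instance : TreeEncodable ℕ := ⟨fun n => toTree n.bits⟩

namespace TreeEncodable

theorem size_cell (a : Cell) : size a = 17 := by
  have hsize : size a = size a.bits := rfl
  rw [hsize, size_prodMk, size_prodMk, size_bool, size_bool, size_bool]

theorem size_eq_size_bits (n : ℕ) : size n = size n.bits := rfl

theorem size_nat (n : ℕ) : size n = 6 * n.size + 1 := by
  have hlist : ∀ l : List Bool, size l = 6 * l.length + 1 := fun l => by
    induction l with
    | nil => rfl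
    | cons b l ih =>
      rw [size_cons, size_bool, ih, List.length_cons]
      lia
  rw [size_eq_size_bits, hlist, Nat.size_eq_bits_len]

end TreeEncodable

/-- The number with the given binary digits, the least significant one first. -/
def ofBits (l : List Bool) : ℕ := l.foldr Nat.bit 0

theorem ofBits_nil : ofBits [] = 0 := rfl

theorem ofBits_cons (b : Bool) (l : List Bool) : ofBits (b :: l) = Nat.bit b (ofBits l) := rfl

theorem ofBits_bits (n : ℕ) : ofBits n.bits = n := by
  induction n using Nat.binaryRec' with
  | zero => rfl
  | bit b n h ih => rw [Nat.bits_append_bit _ _ h, ofBits_cons, ih]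

theorem ofBits_append_replicate_false (l : List Bool) (k : ℕ) :
    ofBits (l ++ List.replicate k false) = ofBits l := by
  induction l with
  | nil =>
    induction k with
    | zero => rfl
    | succ k ih => rw [List.nil_append, List.replicate_succ, ofBits_cons, ← List.nil_append
        (List.replicate k false), ih]; rfl
  | cons b l ih => rw [List.cons_append, ofBits_cons, ih, ofBits_cons]

theorem bits_eq_nil_iff {n : ℕ} : n.bits = [] ↔ n = 0 :=
  ⟨fun h => by rw [← ofBits_bits n, h, ofBits_nil], fun h => h ▸ Nat.zero_bits⟩

theorem bits_bit (b : Bool) (n : ℕ) :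
    (Nat.bit b n).bits = bif n.bits.isEmpty && !b then [] else b :: n.bits := by
  cases b
  · rcases eq_or_ne n 0 with rfl | hn
    · rfl
    · rw [Nat.bits_append_bit _ _ fun h => absurd h hn, List.isEmpty_eq_false_iff.mpr
        (bits_eq_nil_iff.not.mpr hn)]
      rfl
  · rw [Nat.bits_append_bit _ _ fun _ => rfl, Bool.not_true, Bool.and_false, Bool.cond_false]

/-- The pairs of binary digits of two numbers, the shorter number being padded with zeros. -/
def zipBits (m n : ℕ) : List (Bool × Bool) :=
  (m.bits ++ n.bits.map fun _ => false).zip (n.bits ++ m.bits.map fun _ => false)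

theorem ofBits_map_fst_zipBits (m n : ℕ) : ofBits ((zipBits m n).map Prod.fst) = m := by
  rw [zipBits, List.map_fst_zip (by simp [add_comm]), List.map_const',
    ofBits_append_replicate_false, ofBits_bits]

theorem ofBits_map_snd_zipBits (m n : ℕ) : ofBits ((zipBits m n).map Prod.snd) = n := by
  rw [zipBits, List.map_snd_zip (by simp [add_comm]), List.map_const',
    ofBits_append_replicate_false, ofBits_bits]

/-- One step of the addition of binary numbers, which turns the sum and its successor into those of
the numbers with one more digit. Keeping both avoids a carry from the digits of lower order. -/
def addStep (d : Bool × Bool) (s : ℕ × ℕ) : ℕ × ℕ :=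
  (Nat.bit (d.1 ^^ d.2) (bif d.1 && d.2 then s.2 else s.1),
    Nat.bit (!(d.1 ^^ d.2)) (bif d.1 || d.2 then s.2 else s.1))

theorem foldr_addStep (l : List (Bool × Bool)) :
    l.foldr addStep (0, 1) = (ofBits (l.map Prod.fst) + ofBits (l.map Prod.snd),
      ofBits (l.map Prod.fst) + ofBits (l.map Prod.snd) + 1) := by
  induction l with
  | nil => rfl
  | cons d l ih =>
    rw [List.foldr_cons, ih, List.map_cons, List.map_cons, ofBits_cons, ofBits_cons]
    obtain ⟨_ | _, _ | _⟩ := d <;> simp only [addStep, Nat.bit_val, Prod.mk.injEq, Bool.xor_self,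
      Bool.not_false, Bool.not_true, Bool.and_self, Bool.or_self, Bool.xor_false, Bool.xor_true,
      Bool.and_false, Bool.and_true, Bool.or_true, Bool.or_false, Bool.toNat_false,
      Bool.toNat_true, cond_true, cond_false] <;> lia

theorem add_eq_foldr (m n : ℕ) : m + n = ((zipBits m n).foldr addStep (0, 1)).1 := by
  rw [foldr_addStep, ofBits_map_fst_zipBits, ofBits_map_snd_zipBits]

/-- One step of the comparison of binary numbers. The state says whether the first number is at most
the second one, and whether it is less. -/
def leStep (d : Bool × Bool) (s : Bool × Bool) : Bool × Bool :=
  (bif d.1 && !d.2 then s.2 else s.1, bif !d.1 && d.2 then s.1 else s.2)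

theorem foldr_leStep (l : List (Bool × Bool)) :
    l.foldr leStep (true, false) =
      (decide (ofBits (l.map Prod.fst) ≤ ofBits (l.map Prod.snd)),
        decide (ofBits (l.map Prod.fst) < ofBits (l.map Prod.snd))) := by
  induction l with
  | nil => rfl
  | cons d l ih =>
    rw [List.foldr_cons, ih, List.map_cons, List.map_cons, ofBits_cons, ofBits_cons]
    obtain ⟨_ | _, _ | _⟩ := d <;> simp only [leStep, Nat.bit_val, Prod.mk.injEq, Bool.not_false,
      Bool.not_true, Bool.and_self, Bool.and_false, Bool.and_true, Bool.toNat_false,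
      Bool.toNat_true, cond_true, cond_false, decide_eq_decide] <;> lia

theorem decide_le_eq_foldr (m n : ℕ) :
    decide (m ≤ n) = ((zipBits m n).foldr leStep (true, false)).1 := by
  rw [foldr_leStep, ofBits_map_fst_zipBits, ofBits_map_snd_zipBits]

theorem ofBits_mul_eq_foldr (l : List Bool) (n : ℕ) :
    ofBits l * n = l.foldr (fun b k => k + k + bif b then n else 0) 0 := by
  induction l with
  | nil => exact Nat.zero_mul n
  | cons b l ih =>
    rw [List.foldr_cons, ← ih, ofBits_cons, Nat.bit_val]
    cases b <;> simp only [cond_true, cond_false, Bool.toNat_false, Bool.toNat_true] <;> ring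

theorem natSize_add_le (m n : ℕ) : (m + n).size ≤ max m.size n.size + 1 := by
  rw [Nat.size_le, pow_succ]
  have hm := (Nat.lt_size_self m).trans_le
    (Nat.pow_le_pow_right two_pos (le_max_left m.size n.size))
  have hn := (Nat.lt_size_self n).trans_le
    (Nat.pow_le_pow_right two_pos (le_max_right m.size n.size))
  lia

theorem natSize_mul_le (m n : ℕ) : (m * n).size ≤ m.size + n.size := by
  rw [Nat.size_le, pow_add]
  exact Nat.mul_lt_mul'' (Nat.lt_size_self m) (Nat.lt_size_self n)

theorem TreeEncodable.size_bit_le (b : Bool) (n : ℕ) : size (Nat.bit b n) ≤ size n + 6 := by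
  rw [size_eq_size_bits, bits_bit, size_eq_size_bits]
  refine (size_cond_le _ _ _).trans ?_
  rw [size_nil, size_cons, size_bool]
  lia

namespace PolyTime

variable {α β γ σ : Type} [TreeEncodable α] [TreeEncodable β] [TreeEncodable γ] [TreeEncodable σ]

theorem cell_cases {f : Cell → γ → β} {g : γ → Cell} (hf : ∀ a, PolyTime (f a))
    (hg : PolyTime g) : PolyTime fun x => f (g x) x := by
  have hbits : PolyTime fun x => (g x).bits := hg.congr_toTree fun _ => rfl
  have hcases : PolyTime fun x => bif (g x).bits.1 then
      (bif (g x).bits.2.1 then f (some .sep) x else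
        bif (g x).bits.2.2 then f (some (.bit true)) x else f (some (.bit false)) x)
    else (bif (g x).bits.2.1 then
        (bif (g x).bits.2.2 then f (some .slash) x else f (some .minus) x)
        else f none x) := by fun_prop
  exact hcases.congr fun x => by
    rcases g x with _ | (_ | _) | _ | _ | _ <;> rfl

@[fun_prop]
theorem cell_decide_eq {f g : γ → Cell} (hf : PolyTime f) (hg : PolyTime g) :
    PolyTime fun x => decide (f x = g x) :=
  cell_cases (f := fun a x => decide (a = g x))
    (fun a => cell_cases (f := fun b _ => decide (a = b)) (fun _ => .const _) hg) hf

@[fun_prop]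
theorem natBits {f : γ → ℕ} (hf : PolyTime f) : PolyTime fun x => (f x).bits :=
  hf.congr_toTree fun _ => rfl

@[fun_prop]
theorem bit {b : γ → Bool} {f : γ → ℕ} (hb : PolyTime b) (hf : PolyTime f) :
    PolyTime fun x => Nat.bit (b x) (f x) := by
  have hlist : PolyTime fun x => bif (f x).bits.isEmpty && !b x then [] else b x :: (f x).bits := by
    fun_prop
  exact hlist.congr_toTree fun x => congrArg toTree (bits_bit (b x) (f x))

@[fun_prop]
theorem zipBits {f g : γ → ℕ} (hf : PolyTime f) (hg : PolyTime g) :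
    PolyTime fun x => zipBits (f x) (g x) :=
  (hf.natBits.append (map (f := fun _ _ => false) (by fun_prop) hg.natBits)).zip
    (hg.natBits.append (map (f := fun _ _ => false) (by fun_prop) hf.natBits))

@[fun_prop]
protected theorem add {f g : γ → ℕ} (hf : PolyTime f) (hg : PolyTime g) :
    PolyTime fun x => f x + g x := by
  have hfold : PolyTime fun x => (_root_.zipBits (f x) (g x)).foldr addStep (0, 1) := by
    refine foldr_of_measure (f := fun _ => addStep) ?_ (.const _) (by fun_prop)
      (fun s => max (size s.1) (size s.2)) ⟨.X, fun (s, s') => ?_⟩ ⟨2 * .X + 1, fun (s, s') => ?_⟩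
      ⟨6, fun c s d => ?_⟩
    · unfold addStep
      fun_prop
    · rw [size_prodMk, Polynomial.eval_X]
      lia
    · simp only [size_prodMk, Polynomial.eval_add, Polynomial.eval_mul, Polynomial.eval_ofNat,
        Polynomial.eval_X, Polynomial.eval_one]
      lia
    · have hsize : ∀ b b' : Bool, size (Nat.bit b (bif b' then s.2 else s.1)) ≤
          max (size s.1) (size s.2) + 6 := fun b b' =>
        (size_bit_le _ _).trans (Nat.add_le_add_right ((size_cond_le _ _ _).trans_eq
          (max_comm _ _)) 6)
      rw [Polynomial.eval_ofNat]
      exact max_le (hsize _ _) (hsize _ _)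
  exact hfold.fst.congr fun x => add_eq_foldr _ _

@[fun_prop]
protected theorem mul {f g : γ → ℕ} (hf : PolyTime f) (hg : PolyTime g) :
    PolyTime fun x => f x * g x := by
  have hfold : PolyTime fun x => (f x).bits.foldr (fun b k => k + k + bif b then g x else 0) 0 := by
    obtain ⟨p, hp⟩ := hg.size_le
    refine foldr (f := fun x b k => k + k + bif b then g x else 0)
      (.add (by fun_prop) (.cond (by fun_prop) (hg.comp (by fun_prop)) (.const 0))) (.const _)
      (by fun_prop) ⟨p + 12, fun c k b => ?_⟩
    have h₁ := natSize_add_le (k + k) (bif b then g c else 0)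
    have h₂ := natSize_add_le k k
    have h₃ : (bif b then g c else 0).size ≤ (g c).size := by cases b <;> simp
    have h₄ := (hp c).trans (eval_le_eval_of_le p (Nat.le_add_right (size c) (size b)))
    rw [size_nat] at h₄
    rw [size_nat, size_nat, Polynomial.eval_add, Polynomial.eval_ofNat]
    lia
  exact hfold.congr fun x => by rw [← ofBits_mul_eq_foldr, ofBits_bits]

@[fun_prop]
theorem decide_le {f g : γ → ℕ} (hf : PolyTime f) (hg : PolyTime g) :
    PolyTime fun x => decide (f x ≤ g x) := by
  have hfold : PolyTime fun x => (_root_.zipBits (f x) (g x)).foldr leStep (true, false) := by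
    refine foldr (f := fun _ => leStep) ?_ (.const _) (by fun_prop) ⟨0, fun _ (s, s') _ => ?_⟩
    · unfold leStep
      fun_prop
    · rw [leStep, size_prodMk]
      simp only [size_prodMk, size_bool, Polynomial.eval_zero, add_zero, le_refl]
  exact hfold.fst.congr fun x => decide_le_eq_foldr _ _

@[fun_prop]
theorem nat_decide_eq {f g : γ → ℕ} (hf : PolyTime f) (hg : PolyTime g) :
    PolyTime fun x => decide (f x = g x) :=
  ((hf.decide_le hg).and (hg.decide_le hf)).congr fun x => by
    rw [← Bool.decide_and]
    exact decide_eq_decide.mpr le_antisymm_iff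

@[fun_prop]
theorem length {l : γ → List α} (hl : PolyTime l) : PolyTime fun x => (l x).length := by
  refine (foldr (f := fun _ _ k => k + 1) (by fun_prop) (.const 0) hl
    ⟨6, fun c k x => ?_⟩).congr fun x => ?_
  · have := natSize_add_le k 1
    have := Nat.size_one
    rw [size_nat, size_nat, Polynomial.eval_ofNat]
    rcases Nat.eq_zero_or_pos k with rfl | hk
    · simp at *
    · have := Nat.size_pos.mpr hk
      lia
  · induction l x with
    | nil => rfl
    | cons a l ih => rw [List.length_cons, ih, List.foldr_cons]

theorem list_decide_eq [DecidableEq α] {l l' : γ → List α}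
    (h : PolyTime fun p : α × α => decide (p.1 = p.2)) (hl : PolyTime l) (hl' : PolyTime l') :
    PolyTime fun x => decide (l x = l' x) := by
  have hcheck : PolyTime fun x => decide ((l x).length = (l' x).length) &&
      ((l x).zip (l' x)).all fun p => decide (p.1 = p.2) :=
    .and (by fun_prop) (all (h.comp .prod_snd) (by fun_prop))
  exact hcheck.congr fun x => by
    rw [Bool.eq_iff_iff, decide_eq_true_iff, Bool.and_eq_true, decide_eq_true_iff, List.all_eq_true,
      ← List.forall₂_eq_eq_eq, List.forall₂_iff_zip]
    simp

@[fun_prop]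
theorem splitOn {a : Cell} {l : γ → List Cell} (hl : PolyTime l) :
    PolyTime fun x => (l x).splitOn a := by
  refine (foldr (f := fun _ g acc => bif decide (g = a) then [] :: acc else
    (g :: acc.headD []) :: acc.tail) (by fun_prop) (.const [[]]) hl ⟨20, fun c s g => ?_⟩).congr
    fun x => ?_
  · refine (size_cond_le _ _ _).trans ?_
    rw [Polynomial.eval_ofNat]
    cases s with
    | nil =>
      simp only [size_cons, size_nil, size_cell, List.headD_nil, List.tail_nil]
      lia
    | cons =>
      simp only [size_cons, size_nil, size_cell, List.headD_cons, List.tail_cons]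
      lia
  · induction l x with
    | nil => rfl
    | cons g l ih =>
      have hne := List.splitOn_ne_nil a l
      rw [List.splitOn_cons_eq_if_modifyHead, List.foldr_cons, ← ih]
      obtain ⟨k, t, ht⟩ := List.exists_cons_of_ne_nil hne
      rw [ht]
      by_cases h : g = a
      · rw [if_pos (beq_iff_eq.mpr h), decide_eq_true h, cond_true]
      · rw [if_neg (mt beq_iff_eq.mp h), decide_eq_false h, cond_false]
        rfl

end PolyTime

/-- The concatenation of blocks, each of them followed by the symbol `a`. -/
def joinBlocks (a : Cell) (bs : List (List Cell)) : List Cell := bs.flatMap fun b => b ++ [a]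

/-- The blocks of a string, each of them ending before a symbol `a`. -/
def splitBlocks (a : Cell) (l : List Cell) : List (List Cell) := (l.splitOn a).dropLast

theorem splitBlocks_joinBlocks {a : Cell} {bs : List (List Cell)} (h : ∀ b ∈ bs, a ∉ b) :
    splitBlocks a (joinBlocks a bs) = bs := by
  have hsplit : (joinBlocks a bs).splitOn a = bs ++ [[]] := by
    induction bs with
    | nil => rfl
    | cons b bs ih =>
      rw [joinBlocks, List.flatMap_cons, List.append_assoc, List.singleton_append,
        List.splitOn_append_cons_self_of_not_mem (h b List.mem_cons_self)]
      exact congrArg (b :: ·) (ih fun b' hb' => h b' (List.mem_cons_of_mem _ hb'))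
  rw [splitBlocks, hsplit, List.dropLast_concat]

/-- The string with the given binary digits. -/
def bitString (l : List Bool) : List Cell := l.map fun b => some (.bit b)

theorem notMem_bitString {a : Cell} (ha : ∀ b, a ≠ some (.bit b)) (l : List Bool) :
    a ∉ bitString l := fun h => by
  obtain ⟨b, -, hb⟩ := List.mem_map.mp h
  exact ha b hb.symm

/-- One step of reading a natural number from the right. -/
def digitStep : Cell → ℕ → ℕ
  | some (.bit b), n => Nat.bit b n
  | _, n => n

/-- The natural number with the binary digits in a string. -/
def digits (l : List Cell) : ℕ := l.foldr digitStep 0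

theorem digits_bitString (l : List Bool) : digits (bitString l) = ofBits l :=
  List.foldr_map

/-- The triple `(p, n, d)` stands for the fraction `(p - n) / d`. -/
abbrev Frac : Type := ℕ × ℕ × ℕ

namespace Frac

/-- The rational number represented by a triple, which is `0` if the denominator is `0`. -/
def val (x : Frac) : ℚ := ((x.1 : ℚ) - x.2.1) / x.2.2

/-- The sum of two fractions, which are not reduced to lowest terms. -/
protected def add (x y : Frac) : Frac :=
  (x.1 * y.2.2 + y.1 * x.2.2, x.2.1 * y.2.2 + y.2.1 * x.2.2, x.2.2 * y.2.2)

/-- The product of two fractions, which are not reduced to lowest terms. -/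
protected def mul (x y : Frac) : Frac :=
  (x.1 * y.1 + x.2.1 * y.2.1, x.1 * y.2.1 + x.2.1 * y.1, x.2.2 * y.2.2)

/-- The comparison of two fractions with nonzero denominators. -/
protected def le (x y : Frac) : Bool :=
  decide (x.1 * y.2.2 + y.2.1 * x.2.2 ≤ y.1 * x.2.2 + x.2.1 * y.2.2)

/-- A representation of a rational number, which excludes the denominator `0`. -/
def Represents (f : Frac) (x : ℚ) : Prop := f.2.2 ≠ 0 ∧ f.val = x

section

variable {f g : Frac} {x y : ℚ}

theorem Represents.add (hf : f.Represents x) (hg : g.Represents y) :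
    (f.add g).Represents (x + y) := by
  obtain ⟨hf, rfl⟩ := hf
  obtain ⟨hg, rfl⟩ := hg
  refine ⟨mul_ne_zero hf hg, ?_⟩
  have hf' : (f.2.2 : ℚ) ≠ 0 := Nat.cast_ne_zero.mpr hf
  have hg' : (g.2.2 : ℚ) ≠ 0 := Nat.cast_ne_zero.mpr hg
  simp only [val, Frac.add, Nat.cast_add, Nat.cast_mul]
  field_simp
  ring

theorem Represents.mul (hf : f.Represents x) (hg : g.Represents y) :
    (f.mul g).Represents (x * y) := by
  obtain ⟨hf, rfl⟩ := hf
  obtain ⟨hg, rfl⟩ := hg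
  refine ⟨mul_ne_zero hf hg, ?_⟩
  simp only [val, Frac.mul, Nat.cast_add, Nat.cast_mul]
  rw [div_mul_div_comm]
  ring

theorem Represents.le_iff (hf : f.Represents x) (hg : g.Represents y) :
    f.le g = true ↔ x ≤ y := by
  obtain ⟨hf, rfl⟩ := hf
  obtain ⟨hg, rfl⟩ := hg
  have hf' : (0 : ℚ) < f.2.2 := Nat.cast_pos.mpr (Nat.pos_of_ne_zero hf)
  have hg' : (0 : ℚ) < g.2.2 := Nat.cast_pos.mpr (Nat.pos_of_ne_zero hg)
  rw [Frac.le, decide_eq_true_iff, val, val, div_le_div_iff₀ hf' hg', ← Nat.cast_le (α := ℚ)]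
  push_cast
  constructor <;> intro h <;> linarith

theorem Represents.eq_iff (hf : f.Represents x) (hg : g.Represents y) :
    (f.le g && g.le f) = true ↔ x = y := by
  rw [Bool.and_eq_true, hf.le_iff hg, hg.le_iff hf, le_antisymm_iff]

end

theorem represents_zero : Represents (0, 0, 1) 0 := ⟨one_ne_zero, by simp [val]⟩

theorem represents_foldl_add {α : Type} {f : α → Frac} {x : α → ℚ}
    (h : ∀ a, (f a).Represents (x a)) {s : Frac} {y : ℚ} (hs : s.Represents y) (l : List α) :
    (l.foldl (fun s a => s.add (f a)) s).Represents (y + (l.map x).sum) := by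
  induction l generalizing s y with
  | nil => exact (add_zero y).symm ▸ hs
  | cons a l ih =>
    rw [List.map_cons, List.sum_cons, ← add_assoc]
    exact ih (hs.add (h a))

/-- The maximal number of binary digits in a fraction. -/
def height (x : Frac) : ℕ := max x.1.size (max x.2.1.size x.2.2.size)

theorem height_add_le (x y : Frac) : (x.add y).height ≤ x.height + (y.height + 1) := by
  obtain ⟨a, b, c⟩ := x
  obtain ⟨a', b', c'⟩ := y
  have h₁ := natSize_add_le (a * c') (a' * c)
  have h₂ := natSize_add_le (b * c') (b' * c)
  have h₃ := natSize_mul_le a c'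
  have h₄ := natSize_mul_le a' c
  have h₅ := natSize_mul_le b c'
  have h₆ := natSize_mul_le b' c
  have h₇ := natSize_mul_le c c'
  simp only [height, Frac.add]
  lia

theorem size_eq (x : Frac) : size x = 6 * (x.1.size + x.2.1.size + x.2.2.size) + 5 := by
  rw [size_prodMk, size_prodMk, size_nat, size_nat, size_nat]
  lia

theorem height_le_size (x : Frac) : x.height ≤ size x := by
  rw [size_eq, height]
  lia

theorem size_le_height (x : Frac) : size x ≤ 18 * x.height + 5 := by
  rw [size_eq, height]
  lia

end Frac

/-- One step of reading a rational number from the right: the state consists of the sign, the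
natural number being read and the denominator. -/
def ratStep : Cell → Bool × ℕ × ℕ → Bool × ℕ × ℕ
  | some (.bit b), s => (s.1, Nat.bit b s.2.1, s.2.2)
  | some .slash, s => (s.1, 0, s.2.1)
  | some .minus, s => (true, s.2)
  | _, s => s

/-- The fraction with given sign, numerator and denominator. -/
def signedFrac (s : Bool × ℕ × ℕ) : Frac :=
  (bif s.1 then 0 else s.2.1, bif s.1 then s.2.1 else 0, s.2.2)

/-- The fraction written in a string. -/
def readRat (l : List Cell) : Frac := signedFrac (l.foldr ratStep (false, 0, 0))

/-- The string of a rational number, as in `LEMMInstance.encodeRat` but without the separator. -/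
def ratString (r : ℚ) : List Cell :=
  (if r < 0 then [some .minus] else []) ++ bitString r.num.natAbs.bits ++ [some .slash] ++
    bitString r.den.bits

theorem sep_notMem_ratString (r : ℚ) : some LEMMSymbol.sep ∉ ratString r := by
  unfold ratString
  split_ifs <;> simp [notMem_bitString]

theorem foldr_ratStep_bitString (l : List Bool) (s : Bool × ℕ × ℕ) :
    (bitString l).foldr ratStep s = (s.1, l.foldr Nat.bit s.2.1, s.2.2) := by
  induction l with
  | nil => rfl
  | cons b l ih =>
    rw [bitString, List.map_cons, List.foldr_cons, ← bitString, ih]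
    rfl

theorem foldr_ratStep_ratString (r : ℚ) :
    (ratString r).foldr ratStep (false, 0, 0) = (decide (r < 0), r.num.natAbs, r.den) := by
  have hnum : r.num.natAbs.bits.foldr Nat.bit 0 = r.num.natAbs := ofBits_bits _
  have hden : r.den.bits.foldr Nat.bit 0 = r.den := ofBits_bits _
  rw [ratString, List.foldr_append, List.foldr_append, List.foldr_append, foldr_ratStep_bitString,
    List.foldr_cons, List.foldr_nil, foldr_ratStep_bitString, ratStep, hden, hnum]
  by_cases h : r < 0
  · rw [if_pos h, decide_eq_true h]
    rfl
  · rw [if_neg h, decide_eq_false h]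
    rfl

theorem represents_readRat_ratString (r : ℚ) : (readRat (ratString r)).Represents r := by
  have habs : ((r.num.natAbs : ℤ) : ℚ) = (|r.num| : ℤ) := by rw [Int.natCast_natAbs]
  rw [Int.cast_natCast] at habs
  rw [readRat, foldr_ratStep_ratString, signedFrac]
  refine ⟨r.den_ne_zero, ?_⟩
  rw [Frac.val]
  conv_rhs => rw [← Rat.num_div_den r]
  by_cases hr : r < 0
  · simp [hr, habs, abs_of_neg (Rat.num_neg.mpr hr)]
  · simp [hr, habs, abs_of_nonneg (Rat.num_nonneg.mpr (not_lt.mp hr))]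

theorem coprime_of_mul_add_one_eq {u v N d : ℕ} (h : u * N + 1 = v * d) : N.Coprime d := by
  have hdvd : N.gcd d ∣ u * N + 1 := h ▸ (Nat.gcd_dvd_right N d).mul_left v
  exact Nat.dvd_one.mp ((Nat.dvd_add_right ((Nat.gcd_dvd_left N d).mul_left u)).mp hdvd)

theorem eq_and_eq_of_mul_add_one_eq {u v u' v' N d : ℕ} (hu : u < d) (hu' : u' < d)
    (h : u * N + 1 = v * d) (h' : u' * N + 1 = v' * d) : u = u' ∧ v = v' := by
  have hcop : IsCoprime (d : ℤ) N :=
    (Nat.isCoprime_iff_coprime.mpr (coprime_of_mul_add_one_eq h)).symm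
  have hdvd : (d : ℤ) ∣ ((u : ℤ) - u') * N := by
    refine ⟨(v : ℤ) - v', ?_⟩
    zify at h h'
    linear_combination h - h'
  have hsub := Int.eq_zero_of_abs_lt_dvd (hcop.dvd_of_dvd_mul_right hdvd) (by rw [abs_lt]; lia)
  obtain rfl : u = u' := by lia
  exact ⟨rfl, Nat.eq_of_mul_eq_mul_right (Nat.zero_lt_of_lt hu) (h.symm.trans h')⟩

theorem eq_and_eq_of_sub_eq_sub {p n p' n' : ℕ} (h : p * n = 0) (h' : p' * n' = 0)
    (hsub : (p : ℤ) - n = p' - n') : p = p' ∧ n = n' := by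
  rcases Nat.mul_eq_zero.mp h with rfl | rfl <;> rcases Nat.mul_eq_zero.mp h' with rfl | rfl <;> lia

theorem natAbs_sub_of_mul_eq_zero {p n : ℕ} (h : p * n = 0) : ((p : ℤ) - n).natAbs = p + n := by
  rcases Nat.mul_eq_zero.mp h with rfl | rfl <;> simp

theorem exists_mul_add_one_eq {N d : ℕ} (hd : d ≠ 0) (h : N.Coprime d) :
    ∃ u v : ℕ, u < d ∧ v ≤ N + 1 ∧ u * N + 1 = v * d := by
  have : NeZero d := ⟨hd⟩
  obtain ⟨u, hu⟩ : ∃ u : ℕ, u = (-(N : ZMod d)⁻¹).val := ⟨_, rfl⟩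
  have hlt : u < d := hu ▸ ZMod.val_lt _
  obtain ⟨v, hv⟩ : d ∣ u * N + 1 := by
    rw [← ZMod.natCast_eq_zero_iff, Nat.cast_add, Nat.cast_mul, hu, ZMod.natCast_zmod_val]
    linear_combination -(ZMod.coe_mul_inv_eq_one N h)
  refine ⟨u, v, hlt, ?_, hv.trans (mul_comm d v)⟩
  by_contra! hlt'
  have hle : d * (N + 2) ≤ d * v := Nat.mul_le_mul_left d hlt'
  have hle' : u * N ≤ d * N := Nat.mul_le_mul_right N hlt.le
  lia

/-- A fraction in a certificate, together with a Bézout relation `u * |p - n| + 1 = v * d`, given by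
`(u, v)`, which shows that the fraction is in lowest terms. -/
abbrev CertNumber : Type := Frac × ℕ × ℕ

namespace CertNumber

/-- Tests the Bézout relation. Together with the bound on `u`, it makes the certificate of a
rational number unique. -/
def canonical (t : CertNumber) : Bool :=
  decide (t.1.1 * t.1.2.1 = 0) && (decide (t.2.1 + 1 ≤ t.1.2.2) &&
    decide (t.2.1 * (t.1.1 + t.1.2.1) + 1 = t.2.2 * t.1.2.2))

/-- The string of a number in a certificate. -/
def write (t : CertNumber) : List Cell :=
  joinBlocks (some .slash) ([t.1.1, t.1.2.1, t.1.2.2, t.2.1, t.2.2].map fun k => bitString k.bits)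

/-- Reads the string of a number in a certificate. -/
def read (l : List Cell) : CertNumber :=
  let t := (splitBlocks (some .slash) l).map digits
  ((t.headD 0, t.tail.headD 0, t.tail.tail.headD 0), t.tail.tail.tail.headD 0,
    t.tail.tail.tail.tail.headD 0)

theorem read_write (t : CertNumber) : read (write t) = t := by
  have hmem : ∀ b ∈ [t.1.1, t.1.2.1, t.1.2.2, t.2.1, t.2.2].map (fun k => bitString k.bits),
      some LEMMSymbol.slash ∉ b := List.forall_mem_map.mpr fun k _ => notMem_bitString (by simp) _
  rw [read, write, splitBlocks_joinBlocks hmem]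
  simp [digits_bitString, ofBits_bits]

theorem sep_notMem_write (t : CertNumber) : some .sep ∉ write t := by
  simp [write, joinBlocks, notMem_bitString]

theorem canonical_iff (t : CertNumber) : canonical t = true ↔
    t.1.1 * t.1.2.1 = 0 ∧ t.2.1 < t.1.2.2 ∧ t.2.1 * (t.1.1 + t.1.2.1) + 1 = t.2.2 * t.1.2.2 := by
  simp only [canonical, Bool.and_eq_true, decide_eq_true_eq, Nat.lt_iff_add_one_le]

theorem canonical_injective {s t : CertNumber} (hs : canonical s = true) (ht : canonical t = true)
    (h : s.1.val = t.1.val) : s = t := by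
  rw [canonical_iff] at hs ht
  obtain ⟨⟨p, n, d⟩, u, v⟩ := s
  obtain ⟨⟨p', n', d'⟩, u', v'⟩ := t
  obtain ⟨hpn, hud, hbez⟩ := hs
  obtain ⟨hpn', hud', hbez'⟩ := ht
  simp only [Frac.val] at *
  obtain ⟨hnum, hden⟩ := Rat.div_int_inj (a := (p : ℤ) - n) (b := d) (c := (p' : ℤ) - n')
    (d := d') (by lia) (by lia)
    (by rw [natAbs_sub_of_mul_eq_zero hpn]; exact coprime_of_mul_add_one_eq hbez)
    (by rw [natAbs_sub_of_mul_eq_zero hpn']; exact coprime_of_mul_add_one_eq hbez')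
    (by push_cast; exact h)
  obtain rfl : d = d' := Nat.cast_injective hden
  obtain ⟨rfl, rfl⟩ := eq_and_eq_of_sub_eq_sub hpn hpn' hnum
  obtain ⟨rfl, rfl⟩ := eq_and_eq_of_mul_add_one_eq hud hud' hbez hbez'
  rfl

theorem exists_canonical (q : ℚ) : ∃ t : CertNumber, canonical t = true ∧ t.1.val = q ∧
    t.1.1 ≤ q.num.natAbs ∧ t.1.2.1 ≤ q.num.natAbs ∧ t.1.2.2 = q.den ∧ t.2.1 ≤ q.den ∧
    t.2.2 ≤ q.num.natAbs + 1 := by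
  obtain ⟨u, v, hu, hv, hbez⟩ := exists_mul_add_one_eq q.den_ne_zero q.reduced
  have habs : q.num.toNat + (-q.num).toNat = q.num.natAbs := by lia
  have hsub : (q.num.toNat : ℤ) - (-q.num).toNat = q.num := by lia
  refine ⟨((q.num.toNat, (-q.num).toNat, q.den), u, v), (canonical_iff _).mpr ⟨?_, hu, ?_⟩, ?_,
    ?_, ?_, rfl, hu.le, hv⟩
  · exact Nat.mul_eq_zero.mpr (by lia)
  · exact habs.symm ▸ hbez
  · have hsub' : (q.num.toNat : ℚ) - (-q.num).toNat = q.num := by exact_mod_cast hsub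
    rw [Frac.val, hsub', Rat.num_div_den]
  · exact Nat.le.intro habs
  · exact Nat.le.intro ((Nat.add_comm _ _).trans habs)

/-- The number in a certificate that represents a given rational number. -/
noncomputable def ofRat (q : ℚ) : CertNumber := (exists_canonical q).choose

theorem canonical_ofRat (q : ℚ) : canonical (ofRat q) = true :=
  (exists_canonical q).choose_spec.1

theorem represents_ofRat (q : ℚ) : (ofRat q).1.Represents q :=
  ⟨Nat.ne_zero_of_lt ((canonical_iff _).mp (canonical_ofRat q)).2.1,
    (exists_canonical q).choose_spec.2.1⟩

theorem ofRat_val {t : CertNumber} (h : canonical t = true) : ofRat t.1.val = t :=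
  canonical_injective (canonical_ofRat _) h (represents_ofRat _).2

end CertNumber

/-- The string of a certificate. -/
def writeCert (T : List CertNumber) : List Cell := joinBlocks (some .sep) (T.map CertNumber.write)

/-- Reads a certificate. -/
def readCert (l : List Cell) : List CertNumber := (splitBlocks (some .sep) l).map CertNumber.read

theorem readCert_writeCert (T : List CertNumber) : readCert (writeCert T) = T := by
  rw [readCert, writeCert, splitBlocks_joinBlocks (List.forall_mem_map.mpr fun t _ =>
    t.sep_notMem_write), List.map_map, (funext CertNumber.read_write :
      CertNumber.read ∘ CertNumber.write = id), List.map_id]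

/-! ### The verifier -/

/-- Checks whether `x` is the minimum of the variables with a membership bit in the row, or the
maximum if `le` is the reversed order. -/
def checkExtremum (le : Frac → Frac → Bool) (row : List Cell) (X : List Frac) (x : Frac) : Bool :=
  ((row.zip X).all fun p => !decide (p.1 = some (.bit true)) || le x p.2) &&
    (row.zip X).any fun p => decide (p.1 = some (.bit true)) && le p.2 x

/-- The linear form with coefficients written in given blocks. -/
def linearForm (blocks : List (List Cell)) (X : List Frac) : Frac :=
  (blocks.zip X).foldl (fun acc p => acc.add ((readRat p.1).mul p.2)) (0, 0, 1)

/-- The affine form whose coefficients are followed by its constant term. -/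
def affineForm (blocks : List (List Cell)) (X : List Frac) : Frac :=
  (linearForm blocks X).add (readRat ((blocks.drop X.length).headD []))

/-- Checks whether `x` is the value of the affine form. -/
def checkAffine (blocks : List (List Cell)) (X : List Frac) (x : Frac) : Bool :=
  x.le (affineForm blocks X) && (affineForm blocks X).le x

/-- Checks one equation. The state consists of the remaining blocks of the input and the result of
the previous checks; `k` consists of the kind of the variable (whether it is an affine variable, and
whether it is a max variable) and its value. -/
def checkStep (X : List Frac) (s : List (List Cell) × Bool) (k : (Bool × Bool) × Frac) :
    List (List Cell) × Bool :=
  bif k.1.1 then ((s.1.drop X.length).tail, s.2 && checkAffine s.1 X k.2)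
  else (s.1.tail, s.2 && bif k.1.2 then checkExtremum (fun x y => y.le x) (s.1.headD []) X k.2
    else checkExtremum Frac.le (s.1.headD []) X k.2)

/-- Checks all equations. -/
def checkRows (kinds : List (Bool × Bool)) (blocks : List (List Cell)) (X : List Frac) : Bool :=
  ((kinds.zip X).foldl (checkStep X) (blocks, true)).2

/-- The kinds of the variables for given numbers of variables in unary notation. As only the kinds
of the first `n` variables are used, `n` instead of `n - n₁ - n₂` affine variables do no harm. -/
def kinds {α : Type} (n₁ n₂ n : List α) : List (Bool × Bool) :=
  (n₁.map fun _ => (false, false)) ++ ((n₂.map fun _ => (false, true)) ++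
    (n.map fun _ => (true, false)))

/-- Compares the variable number `i` with the threshold. -/
def checkThreshold (neg : Bool) (i β : List Cell) (X : List Frac) : Bool :=
  neg ^^ !(readRat β).le ((X.drop i.length).headD (0, 0, 1))

/-- Checks whether a string is the certificate of a vector with `n` components. -/
def checkCert (n w : List Cell) : Bool :=
  decide (writeCert (readCert w) = w) && ((readCert w).all CertNumber.canonical &&
    decide ((readCert w).length = n.length))

/-- The verifier for given blocks `n₁`, `n₂`, `n`, `i`, `β`, ... of the instance and a given
certificate. -/
def verifyBlocks (neg : Bool) (t : List (List Cell)) (w : List Cell) : Bool :=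
  checkCert (t.tail.tail.headD []) w &&
    (checkRows (kinds (t.headD []) (t.tail.headD []) (t.tail.tail.headD []))
        t.tail.tail.tail.tail.tail ((readCert w).map Prod.fst) &&
      checkThreshold neg (t.tail.tail.tail.headD []) (t.tail.tail.tail.tail.headD [])
        ((readCert w).map Prod.fst))

/-- The verifier, which accepts the certificate of the solution `x` if and only if `x i < β` in case
`neg = false`, and if and only if `β ≤ x i` in case `neg = true`. -/
def verify (neg : Bool) (s : List Cell) : Bool :=
  verifyBlocks neg (splitBlocks (some .sep) ((s.splitOn none).headD []))
    ((s.splitOn none).tail.headD [])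

theorem TreeEncodable.size_drop_le {α : Type} [TreeEncodable α] (l : List α) (k : ℕ) :
    size (l.drop k) ≤ size l := by
  induction k with
  | zero => rfl
  | succ k ih =>
    rw [← List.tail_drop]
    exact (size_tail_le _).trans ih

namespace PolyTime

variable {α γ : Type} [TreeEncodable α] [TreeEncodable γ]

@[fun_prop]
theorem dropLast {l : γ → List α} (hl : PolyTime l) : PolyTime fun x => (l x).dropLast :=
  hl.reverse.tail.reverse.congr fun x => by rw [List.tail_reverse, List.reverse_reverse]

@[fun_prop]
theorem joinBlocks {a : Cell} {bs : γ → List (List Cell)} (hbs : PolyTime bs) :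
    PolyTime fun x => joinBlocks a (bs x) :=
  flatMap (f := fun _ b => b ++ [a]) (by fun_prop) hbs

@[fun_prop]
theorem splitBlocks {a : Cell} {l : γ → List Cell} (hl : PolyTime l) :
    PolyTime fun x => splitBlocks a (l x) :=
  hl.splitOn.dropLast

@[fun_prop]
theorem bitString {l : γ → List Bool} (hl : PolyTime l) : PolyTime fun x => bitString (l x) := by
  have hcond : PolyTime fun p : γ × Bool =>
      bif p.2 then (some (.bit true) : Cell) else some (.bit false) := by fun_prop
  exact map (f := fun _ b => (some (.bit b) : Cell)) (hcond.congr fun p => by cases p.2 <;> rfl) hl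

@[fun_prop]
theorem digits {l : γ → List Cell} (hl : PolyTime l) : PolyTime fun x => digits (l x) := by
  refine foldr (f := fun _ => digitStep) ?_ (.const 0) hl ⟨6, fun c s a => ?_⟩
  · refine cell_cases (f := fun a (p : γ × ℕ × Cell) => digitStep a p.2.1) (fun a => ?_)
      (by fun_prop)
    rcases a with _ | _ | _ | _ | _ <;> simp only [digitStep] <;> fun_prop
  · rw [Polynomial.eval_ofNat]
    rcases a with _ | b | _ | _ | _ <;>
      first | exact size_bit_le b s | exact Nat.le_add_right _ _

@[fun_prop]
theorem frac_add {f g : γ → Frac} (hf : PolyTime f) (hg : PolyTime g) :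
    PolyTime fun x => (f x).add (g x) := by
  unfold Frac.add
  fun_prop

@[fun_prop]
theorem frac_mul {f g : γ → Frac} (hf : PolyTime f) (hg : PolyTime g) :
    PolyTime fun x => (f x).mul (g x) := by
  unfold Frac.mul
  fun_prop

@[fun_prop]
theorem frac_le {f g : γ → Frac} (hf : PolyTime f) (hg : PolyTime g) :
    PolyTime fun x => (f x).le (g x) := by
  unfold Frac.le
  fun_prop

@[fun_prop]
theorem readRat {l : γ → List Cell} (hl : PolyTime l) : PolyTime fun x => readRat (l x) := by
  have hfold : PolyTime fun x => (l x).foldr ratStep (false, 0, 0) := by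
    refine foldr (f := fun _ => ratStep) ?_ (.const _) hl ⟨6, fun c (s, n, d) a => ?_⟩
    · refine cell_cases (f := fun a (p : γ × (Bool × ℕ × ℕ) × Cell) => ratStep a p.2.1)
        (fun a => ?_) (by fun_prop)
      rcases a with _ | _ | _ | _ | _ <;> simp only [ratStep] <;> fun_prop
    · have hzero := size_nat 0
      rw [Nat.size_zero] at hzero
      rw [Polynomial.eval_ofNat]
      rcases a with _ | b | _ | _ | _
      case some.bit =>
        have := size_bit_le b n
        simp only [ratStep, size_prodMk]
        lia
      all_goals
        simp only [ratStep, size_prodMk, size_bool, size_nat d, hzero]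
        lia
  unfold _root_.readRat signedFrac
  fun_prop

@[fun_prop]
theorem certNumber_canonical {f : γ → CertNumber} (hf : PolyTime f) :
    PolyTime fun x => (f x).canonical := by
  unfold CertNumber.canonical
  fun_prop

@[fun_prop]
theorem certNumber_write {f : γ → CertNumber} (hf : PolyTime f) :
    PolyTime fun x => (f x).write := by
  unfold CertNumber.write
  simp only [List.map_cons, List.map_nil]
  fun_prop

@[fun_prop]
theorem certNumber_read {l : γ → List Cell} (hl : PolyTime l) :
    PolyTime fun x => CertNumber.read (l x) := by
  have hmap : PolyTime fun x => (_root_.splitBlocks (some .slash) (l x)).map _root_.digits :=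
    map (f := fun _ => _root_.digits) (by fun_prop) hl.splitBlocks
  unfold CertNumber.read
  fun_prop

@[fun_prop]
theorem readCert {l : γ → List Cell} (hl : PolyTime l) : PolyTime fun x => readCert (l x) :=
  map (f := fun _ => CertNumber.read) (by fun_prop) hl.splitBlocks

@[fun_prop]
theorem writeCert {T : γ → List CertNumber} (hT : PolyTime T) :
    PolyTime fun x => writeCert (T x) :=
  joinBlocks (map (f := fun _ => CertNumber.write) (by fun_prop) hT)

theorem checkExtremum {le : Frac → Frac → Bool} {row : γ → List Cell} {X : γ → List Frac}
    {x : γ → Frac} (hle : PolyTime fun p : Frac × Frac => le p.1 p.2) (hrow : PolyTime row)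
    (hX : PolyTime X) (hx : PolyTime x) :
    PolyTime fun c => checkExtremum le (row c) (X c) (x c) := by
  have hx' : PolyTime fun p : γ × Cell × Frac => x p.1 :=
    hx.comp (f := fun p : γ × Cell × Frac => p.1) (by fun_prop)
  exact (all (f := fun c (p : Cell × Frac) => !decide (p.1 = some (.bit true)) || le (x c) p.2)
      (.or (by fun_prop) (hle.comp (hx'.prodMk (by fun_prop)))) (by fun_prop)).and
    (any (f := fun c (p : Cell × Frac) => decide (p.1 = some (.bit true)) && le p.2 (x c))
      (.and (by fun_prop) (hle.comp (.prodMk (by fun_prop) hx'))) (by fun_prop))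

@[fun_prop]
theorem linearForm {blocks : γ → List (List Cell)} {X : γ → List Frac} (hblocks : PolyTime blocks)
    (hX : PolyTime X) : PolyTime fun c => linearForm (blocks c) (X c) := by
  have hterm : PolyTime fun p : List Cell × Frac => (_root_.readRat p.1).mul p.2 := by fun_prop
  obtain ⟨q, hq⟩ := hterm.size_le
  refine foldl_of_measure (f := fun _ (acc : Frac) (p : List Cell × Frac) =>
    acc.add ((_root_.readRat p.1).mul p.2)) (by fun_prop) (.const _) (by fun_prop) Frac.height
    ⟨.X, fun s => ?_⟩ ⟨18 * .X + 5, fun s => ?_⟩ ⟨q + 1, fun c s x => ?_⟩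
  · rw [Polynomial.eval_X]
    exact s.height_le_size
  · rw [Polynomial.eval_add, Polynomial.eval_mul, Polynomial.eval_X, Polynomial.eval_ofNat,
      Polynomial.eval_ofNat]
    exact s.size_le_height
  · refine (Frac.height_add_le _ _).trans (Nat.add_le_add_left ?_ _)
    rw [Polynomial.eval_add, Polynomial.eval_one]
    exact Nat.add_le_add_right ((Frac.height_le_size _).trans ((hq x).trans
      (eval_le_eval_of_le q (Nat.le_add_left (size x) (size c))))) 1

@[fun_prop]
theorem affineForm {blocks : γ → List (List Cell)} {X : γ → List Frac} (hblocks : PolyTime blocks)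
    (hX : PolyTime X) : PolyTime fun c => affineForm (blocks c) (X c) :=
  (linearForm hblocks hX).frac_add ((hX.drop_length hblocks).headD (.const [])).readRat

@[fun_prop]
theorem checkAffine {blocks : γ → List (List Cell)} {X : γ → List Frac} {x : γ → Frac}
    (hblocks : PolyTime blocks) (hX : PolyTime X) (hx : PolyTime x) :
    PolyTime fun c => checkAffine (blocks c) (X c) (x c) := by
  unfold _root_.checkAffine
  fun_prop

theorem checkStep {X : γ → List Frac} (hX : PolyTime X) :
    PolyTime fun p : γ × (List (List Cell) × Bool) × (Bool × Bool) × Frac =>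
      checkStep (X p.1) p.2.1 p.2.2 := by
  have hX' : PolyTime fun p : γ × (List (List Cell) × Bool) × (Bool × Bool) × Frac => X p.1 :=
    hX.comp (f := fun p : γ × (List (List Cell) × Bool) × (Bool × Bool) × Frac => p.1)
      (by fun_prop)
  exact .cond (by fun_prop) (.prodMk (hX'.drop_length (by fun_prop)).tail (by fun_prop))
    (.prodMk (by fun_prop) (.and (by fun_prop) (.cond (by fun_prop)
      (checkExtremum (by fun_prop) (by fun_prop) hX' (by fun_prop))
      (checkExtremum (by fun_prop) (by fun_prop) hX' (by fun_prop)))))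

@[fun_prop]
theorem checkRows {k : γ → List (Bool × Bool)} {blocks : γ → List (List Cell)} {X : γ → List Frac}
    (hk : PolyTime k) (hblocks : PolyTime blocks) (hX : PolyTime X) :
    PolyTime fun c => checkRows (k c) (blocks c) (X c) := by
  refine PolyTime.snd (foldl (f := fun c => _root_.checkStep (X c)) hX.checkStep (by fun_prop)
    (by fun_prop) ⟨0, fun c (l, b) x => ?_⟩)
  have htail := size_tail_le l
  have hdrop := (size_tail_le (l.drop (X c).length)).trans (size_drop_le l (X c).length)
  refine (size_cond_le _ _ _).trans ?_
  simp only [size_prodMk, size_bool, Polynomial.eval_zero]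
  lia

@[fun_prop]
theorem kinds {n₁ n₂ n : γ → List α} (hn₁ : PolyTime n₁) (hn₂ : PolyTime n₂) (hn : PolyTime n) :
    PolyTime fun x => kinds (n₁ x) (n₂ x) (n x) :=
  (map (f := fun _ _ => (false, false)) (by fun_prop) hn₁).append
    ((map (f := fun _ _ => (false, true)) (by fun_prop) hn₂).append
      (map (f := fun _ _ => (true, false)) (by fun_prop) hn))

@[fun_prop]
theorem checkThreshold {neg : Bool} {i β : γ → List Cell} {X : γ → List Frac} (hi : PolyTime i)
    (hβ : PolyTime β) (hX : PolyTime X) : PolyTime fun x => checkThreshold neg (i x) (β x) (X x) :=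
  (PolyTime.const neg).xor (hβ.readRat.frac_le ((hi.drop_length hX).headD (.const _))).not

@[fun_prop]
theorem checkCert {n w : γ → List Cell} (hn : PolyTime n) (hw : PolyTime w) :
    PolyTime fun x => checkCert (n x) (w x) :=
  (list_decide_eq (by fun_prop) (by fun_prop) hw).and
    ((all (f := fun _ => CertNumber.canonical) (by fun_prop) hw.readCert).and (by fun_prop))

@[fun_prop]
theorem verifyBlocks {neg : Bool} {t : γ → List (List Cell)} {w : γ → List Cell} (ht : PolyTime t)
    (hw : PolyTime w) : PolyTime fun x => verifyBlocks neg (t x) (w x) := by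
  have hX : PolyTime fun x => (_root_.readCert (w x)).map Prod.fst :=
    map (f := fun _ => Prod.fst) (by fun_prop) hw.readCert
  unfold _root_.verifyBlocks
  fun_prop

theorem verify (neg : Bool) : PolyTime (verify neg) := by
  unfold _root_.verify
  fun_prop

end PolyTime

/-! ### Turing machines deciding a property of strings -/

section

variable {A : Type}

/-- The alphabets of a machine that runs a program on binary trees in order to decide a property of
a string. -/
abbrev DecisionSym (A : Type) : IOStack WorkStack → Type := IOStack.Sym A Bool WorkStack.Sym

/-- The stacks of such a machine, with given contents of the input, data and output stacks. -/
def decisionStacks (x : List A) (r y : List Bool) : ∀ k, List (DecisionSym A k) :=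
  ioStacks x (workStacks r [] []) y

theorem singleStack_input (x : List A) :
    singleStack (Γ := DecisionSym A) .input x = decisionStacks x [] [] := by
  funext k
  rcases k with _ | (_ | _ | _) | _ <;> rfl

theorem singleStack_output (y : List Bool) :
    singleStack (Γ := DecisionSym A) .output y = decisionStacks [] [] y := by
  funext k
  rcases k with _ | (_ | _ | _) | _ <;> rfl

section

variable {n : ℕ} {S : ∀ k, List (DecisionSym A k)} {x : List A} {r y : List Bool}

theorem runs_popCase_input {f : Option A → StackProg (DecisionSym A)} {a : A}
    (h : Runs (f (some a)) n (decisionStacks x r y) S) :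
    Runs (popCase .input f : StackProg (DecisionSym A)) (n + 1) (decisionStacks (a :: x) r y) S :=
  .popCase ((update_ioStacks_input (a :: x) x (workStacks r [] []) y).symm ▸ h)

theorem runs_popCase_work_data {f : Option Bool → StackProg (DecisionSym A)} {a : Bool}
    (h : Runs (f (some a)) n (decisionStacks x r y) S) :
    Runs (popCase (.work .data) f : StackProg (DecisionSym A)) (n + 1)
      (decisionStacks x (a :: r) y) S :=
  .popCase (((update_ioStacks_work x (workStacks (a :: r) [] []) y .data r).trans
    (congrArg (ioStacks x · y) (update_workStacks_data (a :: r) r [] []))).symm ▸ h)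

theorem runs_push_output (a : Bool) :
    Runs (push .output a : StackProg (DecisionSym A)) 1 (decisionStacks x r y)
      (decisionStacks x r (a :: y)) :=
  (update_ioStacks_output x (workStacks r [] []) y (a :: y)).subst
    (Runs.push (Γ := DecisionSym A) .output a (decisionStacks x r y))

end

/-- Moves the reversed input to the stack `data`. -/
def readInput [TreeEncodable A] : StackProg (DecisionSym A) :=
  .seq (pushWord (code ([] : List A))).lift
    (.loop .input Option.isSome (.popCase .input fun o : Option A =>
      o.elim .skip fun a => (pushWord (true :: code a)).lift))

theorem runs_readInput [TreeEncodable A] {s : ℕ} (hs : ∀ a : A, size a ≤ s) (x : List A) :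
    Runs readInput ((s + 4) * x.length + 3) (decisionStacks x [] [])
      (decisionStacks [] (code x.reverse) []) := by
  have hstep (l : List A) (a : A) (u : List A) :
      Runs (.popCase .input fun o : Option A =>
          o.elim .skip fun a => (pushWord (true :: code a)).lift : StackProg (DecisionSym A))
        (s + 3) (decisionStacks (a :: u) (code l) []) (decisionStacks u (code (a :: l)) []) := by
    refine runs_popCase_input (((runs_pushWord (true :: code a) (code l) [] []).lift u []).mono ?_)
    rw [List.length_cons, length_code]
    exact Nat.add_le_add_right (hs a) 2
  have hloop := Runs.loop_foldl (Γ := DecisionSym A) (k := .input) (p := Option.isSome)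
    (fun (l u : List A) => decisionStacks u (code l) []) (fun l a => a :: l)
    (fun _ => rfl) (fun _ _ _ => rfl) hstep [] x
  rw [List.foldl_flip_cons_eq_append, List.append_nil, List.map_id'] at hloop
  refine (((runs_pushWord (code ([] : List A)) [] [] []).lift x []).seq hloop).mono ?_
  rw [code_nil, List.length_singleton]
  lia

/-- Moves a truth value from the stack `data` to the output. It is the second of the five symbols of
its code. -/
def writeOutput : StackProg (DecisionSym A) :=
  .seq (pop .data).lift (.popCase (.work .data) fun o : Option Bool =>
    .seq (.push .output (o.getD false))
      (.seq (pop .data) (.seq (pop .data) (pop .data)) : TreeProg).lift)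

theorem runs_writeOutput (v : Bool) :
    Runs (writeOutput (A := A)) 10 (decisionStacks [] (code v) []) (decisionStacks [] [] [v]) := by
  have hcode : code v = [true, v, !v, false, false] := by cases v <;> rfl
  rw [hcode]
  exact ((runs_pop_data true [v, !v, false, false] [] []).lift [] []).seq (n := 8)
    (runs_popCase_work_data ((runs_push_output v).seq (n := 6)
      (((runs_pop_data (!v) [false, false] [] []).seq ((runs_pop_data false [false] [] []).seq
        (runs_pop_data false [] [] []))).lift [] [v])))

theorem PolyTime.nonempty_tm2ComputableInPolyTime [Finite A] [TreeEncodable A] {α : Type}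
    {f : List A → Bool} (hf : PolyTime f) (e : α → List A) :
    Nonempty (Turing.TM2ComputableInPolyTime e Computability.encodeBool fun a => f (e a)) := by
  obtain ⟨s, hs⟩ := (Set.finite_range (size : A → ℕ)).bddAbove
  replace hs (a : A) : size a ≤ s := hs ⟨a, rfl⟩
  have size_le (x : List A) : size x ≤ (s + 1) * x.length + 1 := by
    induction x with
    | nil => exact Nat.le_add_left _ _
    | cons a x ih =>
      have := hs a
      rw [size_cons, List.length_cons]
      lia
  obtain ⟨c, p, hc⟩ : PolyTime fun x : List A => f x.reverse := hf.comp (by fun_prop)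
  obtain ⟨q, htime⟩ : ∃ q : Polynomial ℕ, ∀ x : List A,
      (s + 4) * x.length + 3 + (p.eval (size x.reverse) + 10) ≤ q.eval x.length := by
    refine ⟨.C (s + 4) * .X + 13 + p.comp (.C (s + 1) * .X + 1), fun x => ?_⟩
    have hp := eval_le_eval_of_le p (size_le x.reverse)
    rw [List.length_reverse] at hp
    simp only [Polynomial.eval_add, Polynomial.eval_mul, Polynomial.eval_C, Polynomial.eval_X,
      Polynomial.eval_ofNat, Polynomial.eval_comp, Polynomial.eval_one]
    lia
  refine StackProg.nonempty_tm2ComputableInPolyTime (Γ := DecisionSym A) (k₀ := .input)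
    (k₁ := .output) (.seq readInput (.seq c.lift writeOutput)) q fun a => ?_
  have hrun := hc (e a).reverse [] [] []
  simp only [List.append_nil, List.reverse_reverse] at hrun
  rw [singleStack_input, Computability.encodeBool, singleStack_output]
  exact ((runs_readInput hs (e a)).seq ((hrun.lift [] []).seq (runs_writeOutput _))).mono
    (htime (e a))

end

/-! ### Correctness of the verifier -/

section

variable {ι R : Type*} [LinearOrder R] {s : Finset ι} {f : ι → R} {a : R}

theorem inf'_eq_iff (hs : s.Nonempty) :
    s.inf' hs f = a ↔ (∀ i ∈ s, a ≤ f i) ∧ ∃ i ∈ s, f i ≤ a := by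
  rw [le_antisymm_iff, Finset.le_inf'_iff, Finset.inf'_le_iff, and_comm]

theorem sup'_eq_iff (hs : s.Nonempty) :
    s.sup' hs f = a ↔ (∀ i ∈ s, f i ≤ a) ∧ ∃ i ∈ s, a ≤ f i := by
  rw [le_antisymm_iff, Finset.sup'_le_iff, Finset.le_sup'_iff]

end

namespace LEMM

/-- The right-hand sides of the equations, whose fixed points are the feasible solutions. -/
def rhs {R : Type} [Semiring R] [LinearOrder R] (L : LEMM R) (x : Fin L.n → R) (r : Fin L.n) : R :=
  if h : (r : ℕ) < L.n₁ + L.n₂ then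
    if (r : ℕ) < L.n₁ then (L.J r h).inf' (L.J_nonempty r h) x
    else (L.J r h).sup' (L.J_nonempty r h) x
  else ∑ l, L.q r (not_lt.mp h) l * x l + L.b r (not_lt.mp h)

section

variable {R : Type} [Semiring R] [LinearOrder R] (L : LEMM R) (x : Fin L.n → R) {r : Fin L.n}

theorem rhs_of_min (h : (r : ℕ) < L.n₁) :
    L.rhs x r = (L.J r (Nat.lt_add_right L.n₂ h)).inf' (L.J_nonempty r _) x := by
  rw [rhs, dif_pos (Nat.lt_add_right L.n₂ h), if_pos h]

theorem rhs_of_max (h₁ : L.n₁ ≤ (r : ℕ)) (h₂ : (r : ℕ) < L.n₁ + L.n₂) :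
    L.rhs x r = (L.J r h₂).sup' (L.J_nonempty r h₂) x := by
  rw [rhs, dif_pos h₂, if_neg (not_lt.mpr h₁)]

theorem rhs_of_affine (h : L.n₁ + L.n₂ ≤ (r : ℕ)) :
    L.rhs x r = ∑ l, L.q r h l * x l + L.b r h := by
  rw [rhs, dif_neg (not_lt.mpr h)]

end

theorem isFeasible_iff_rhs_eq (L : LEMM ℝ) (x : Fin L.n → ℝ) : L.IsFeasible x ↔ L.rhs x = x := by
  rw [funext_iff]
  refine ⟨fun ⟨hmin, hmax, haffine⟩ r => ?_, fun h => ⟨fun r hr => ?_, fun r hr₁ hr₂ => ?_,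
    fun r hr => ?_⟩⟩
  · rcases lt_or_ge (r : ℕ) L.n₁ with hr₁ | hr₁
    · exact (L.rhs_of_min x hr₁).trans (hmin r hr₁).symm
    rcases lt_or_ge (r : ℕ) (L.n₁ + L.n₂) with hr₂ | hr₂
    · exact (L.rhs_of_max x hr₁ hr₂).trans (hmax r hr₁ hr₂).symm
    · exact (L.rhs_of_affine x hr₂).trans (haffine r hr₂).symm
  · exact (h r).symm.trans (L.rhs_of_min x hr)
  · exact (h r).symm.trans (L.rhs_of_max x hr₁ hr₂)
  · exact (h r).symm.trans (L.rhs_of_affine x hr)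

theorem rhs_toReal (L : LEMM ℚ) (x : Fin L.n → ℚ) (r : Fin L.n) :
    L.toReal.rhs (fun l => (x l : ℝ)) r = (L.rhs x r : ℝ) := by
  have hmono : Monotone ((↑) : ℚ → ℝ) := Rat.cast_mono
  rcases lt_or_ge (r : ℕ) L.n₁ with hr₁ | hr₁
  · rw [L.rhs_of_min x hr₁]
    exact (L.toReal.rhs_of_min _ hr₁).trans
      (Finset.apply_inf'_eq_inf'_comp _ _ fun _ _ => hmono.map_min).symm
  rcases lt_or_ge (r : ℕ) (L.n₁ + L.n₂) with hr₂ | hr₂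
  · rw [L.rhs_of_max x hr₁ hr₂]
    exact (L.toReal.rhs_of_max _ hr₁ hr₂).trans
      (Finset.apply_sup'_eq_sup'_comp _ _ fun _ _ => hmono.map_max).symm
  · rw [L.rhs_of_affine x hr₂, Rat.cast_add, Rat.cast_sum]
    simp only [Rat.cast_mul]
    exact L.toReal.rhs_of_affine _ hr₂

theorem isFeasible_toReal_iff (L : LEMM ℚ) (x : Fin L.n → ℚ) :
    L.toReal.IsFeasible (fun l => (x l : ℝ)) ↔ L.rhs x = x :=
  (L.toReal.isFeasible_iff_rhs_eq _).trans <| funext_iff.trans <| (forall_congr' fun r =>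
    (L.rhs_toReal x r).symm ▸ Rat.cast_inj).trans funext_iff.symm

open LEMMSymbol

/-- The blocks of an equation. -/
def rowBlocks (L : LEMM ℚ) (r : Fin L.n) : List (List Cell) :=
  if h : (r : ℕ) < L.n₁ + L.n₂ then
    [(List.finRange L.n).map fun l => some (bit (decide (l ∈ L.J r h)))]
  else
    ((List.finRange L.n).map fun l => ratString (L.q r (not_lt.mp h) l)) ++
      [ratString (L.b r (not_lt.mp h))]

theorem sep_notMem_rowBlocks (L : LEMM ℚ) (r : Fin L.n) :
    ∀ b ∈ L.rowBlocks r, some sep ∉ b := by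
  unfold rowBlocks
  split_ifs
  · simp
  · simp [or_imp, forall_and, sep_notMem_ratString]

end LEMM

theorem joinBlocks_append (a : Cell) (bs bs' : List (List Cell)) :
    joinBlocks a (bs ++ bs') = joinBlocks a bs ++ joinBlocks a bs' :=
  List.flatMap_append

namespace LEMMInstance

open LEMMSymbol

/-- The block of a natural number in unary notation. -/
def unaryBlock (m : ℕ) : List Cell := List.replicate m (some (bit true))

theorem length_unaryBlock (m : ℕ) : (unaryBlock m).length = m := List.length_replicate

/-- The blocks of an instance. -/
def blocks (I : LEMMInstance) : List (List Cell) :=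
  unaryBlock I.L.n₁ :: unaryBlock I.L.n₂ :: unaryBlock I.L.n :: unaryBlock I.i ::
    ratString I.β :: (List.finRange I.L.n).flatMap I.L.rowBlocks

theorem map_some_encodeUnary (m : ℕ) :
    (encodeUnary m).map some = joinBlocks (some sep) [unaryBlock m] := by
  simp [encodeUnary, joinBlocks, unaryBlock]

theorem map_some_encodeRat (r : ℚ) :
    (encodeRat r).map some = joinBlocks (some sep) [ratString r] := by
  rw [encodeRat, joinBlocks, ratString]
  split_ifs <;> simp [bitString, Function.comp_def]

theorem map_some_encodeRow (L : LEMM ℚ) (r : Fin L.n) :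
    (encodeRow L r).map some = joinBlocks (some sep) (L.rowBlocks r) := by
  unfold encodeRow LEMM.rowBlocks
  split_ifs with h
  · simp [joinBlocks, Function.comp_def]
  · rw [joinBlocks_append, List.map_append, map_some_encodeRat, List.map_flatMap]
    simp only [map_some_encodeRat, joinBlocks, List.flatMap_singleton, List.flatMap_map]

theorem map_some_encode (I : LEMMInstance) :
    I.encode.map some = joinBlocks (some sep) I.blocks := by
  have hrows : ((List.finRange I.L.n).flatMap (encodeRow I.L)).map some =
      joinBlocks (some sep) ((List.finRange I.L.n).flatMap I.L.rowBlocks) := by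
    rw [List.map_flatMap, joinBlocks, List.flatMap_assoc]
    exact List.flatMap_congr fun r _ => map_some_encodeRow I.L r
  simp only [encode, List.map_append, map_some_encodeUnary, map_some_encodeRat, hrows,
    ← joinBlocks_append]
  rfl

theorem sep_notMem_blocks (I : LEMMInstance) : ∀ b ∈ I.blocks, some sep ∉ b := by
  have hunary (m : ℕ) : some sep ∉ unaryBlock m := by simp [unaryBlock]
  simp only [blocks, List.forall_mem_cons, hunary, sep_notMem_ratString, List.mem_flatMap,
    not_false_eq_true, true_and]
  rintro b ⟨r, -, hb⟩
  exact I.L.sep_notMem_rowBlocks r b hb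

theorem verify_encodePair (neg : Bool) (I : LEMMInstance) (w : List LEMMSymbol) :
    verify neg (lemmHaltingProblem.encodePair (I, w)) =
      verifyBlocks neg I.blocks (w.map some) := by
  have hnone (l : List LEMMSymbol) : (none : Cell) ∉ l.map some := by simp
  have hsplit : ((lemmHaltingProblem.encodePair (I, w)).splitOn none : List (List Cell)) =
      [I.encode.map some, w.map some] := by
    rw [← List.splitOn_eq_singleton (hnone w)]
    exact List.splitOn_append_cons_self_of_not_mem (hnone I.encode) _
  rw [map_some_encode] at hsplit
  unfold verify
  rw [hsplit]
  exact congrArg (verifyBlocks neg · _) (splitBlocks_joinBlocks I.sep_notMem_blocks)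

end LEMMInstance

section

variable {n : ℕ} {X : Fin n → Frac} {x : Fin n → ℚ}

open LEMMSymbol

theorem checkExtremum_iff (le : Frac → Frac → Bool) (J : Finset (Fin n)) (X : Fin n → Frac)
    (f : Frac) :
    checkExtremum le ((List.finRange n).map fun l => some (bit (decide (l ∈ J))))
      ((List.finRange n).map X) f = true ↔
      (∀ l ∈ J, le f (X l) = true) ∧ ∃ l ∈ J, le (X l) f = true := by
  rw [checkExtremum, List.zip_map']
  simp [or_iff_not_imp_left]

theorem represents_linearForm (hX : ∀ l, (X l).Represents (x l)) (q : Fin n → ℚ)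
    (rest : List (List Cell)) :
    (linearForm (((List.finRange n).map fun l => ratString (q l)) ++ rest)
      ((List.finRange n).map X)).Represents (∑ l, q l * x l) := by
  have hzip : (((List.finRange n).map fun l => ratString (q l)) ++ rest).zip
      ((List.finRange n).map X) = (List.finRange n).map fun l => (ratString (q l), X l) := by
    rw [← List.append_nil ((List.finRange n).map X),
      List.zip_append ((List.length_map _).trans (List.length_map _).symm), List.zip_map',
      List.zip_nil_right, List.append_nil]
  rw [linearForm, hzip, List.foldl_map, Fin.sum_univ_def, ← zero_add (List.sum _)]
  exact Frac.represents_foldl_add (fun l => (represents_readRat_ratString (q l)).mul (hX l))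
    Frac.represents_zero _

theorem checkAffine_iff (hX : ∀ l, (X l).Represents (x l)) (q : Fin n → ℚ) (b : ℚ)
    (rest : List (List Cell)) (r : Fin n) :
    checkAffine (((List.finRange n).map fun l => ratString (q l)) ++ ratString b :: rest)
      ((List.finRange n).map X) (X r) = true ↔ ∑ l, q l * x l + b = x r := by
  have hdrop : (((List.finRange n).map fun l => ratString (q l)) ++ ratString b :: rest).drop
      ((List.finRange n).map X).length = ratString b :: rest :=
    List.drop_left' ((List.length_map _).trans (List.length_map _).symm)
  rw [checkAffine, affineForm, hdrop, List.headD_cons, (hX r).eq_iff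
    ((represents_linearForm hX q _).add (represents_readRat_ratString b)), eq_comm]

theorem checkThreshold_iff (neg : Bool) (hX : ∀ l, (X l).Represents (x l)) (i : Fin n) (β : ℚ) :
    checkThreshold neg (LEMMInstance.unaryBlock i) (ratString β) ((List.finRange n).map X) = true ↔
      (neg = true ↔ ¬ x i < β) := by
  have hhead : (((List.finRange n).map X).drop (LEMMInstance.unaryBlock i).length).headD
      (0, 0, 1) = X i := by
    rw [LEMMInstance.length_unaryBlock, List.headD_eq_head?_getD, List.head?_drop]
    simp
  rw [checkThreshold, hhead, not_lt, ← (represents_readRat_ratString β).le_iff (hX i)]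
  cases neg <;> simp

end

/-- The kind of the variable number `r`. -/
def kind (n₁ n₂ r : ℕ) : Bool × Bool :=
  if r < n₁ then (false, false) else if r < n₁ + n₂ then (false, true) else (true, false)

theorem kinds_zip {α β : Type} {l₁ l₂ l : List α} {n : ℕ} (hl : l.length = n) (X : Fin n → β) :
    (kinds l₁ l₂ l).zip ((List.finRange n).map X) =
      (List.finRange n).map fun r : Fin n => (kind l₁.length l₂.length r, X r) := by
  refine List.ext_getElem (by simp [kinds]; lia) fun i hi hi' => ?_
  simp only [List.length_map, List.length_finRange] at hi'
  simp only [List.getElem_zip, kinds, List.getElem_append, List.length_map, List.getElem_map,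
    List.getElem_finRange, Fin.val_cast, kind]
  congr 1
  split_ifs <;> first | rfl | lia

namespace LEMM

variable {L : LEMM ℚ} {X : Fin L.n → Frac} {x : Fin L.n → ℚ}

theorem checkStep_rowBlocks (hX : ∀ l, (X l).Represents (x l)) (r : Fin L.n)
    (rest : List (List Cell)) (ok : Bool) :
    checkStep ((List.finRange L.n).map X) (L.rowBlocks r ++ rest, ok) (kind L.n₁ L.n₂ r, X r) =
      (rest, ok && decide (L.rhs x r = x r)) := by
  unfold checkStep kind rowBlocks
  rcases lt_or_ge (r : ℕ) L.n₁ with hr₁ | hr₁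
  · simp only [if_pos hr₁, dif_pos (Nat.lt_add_right L.n₂ hr₁), cond_false]
    refine congrArg (fun b => (rest, ok && b)) (Bool.eq_iff_iff.mpr ?_)
    rw [decide_eq_true_iff, L.rhs_of_min x hr₁, inf'_eq_iff]
    simp only [← (hX _).le_iff (hX _)]
    exact checkExtremum_iff Frac.le _ X (X r)
  rcases lt_or_ge (r : ℕ) (L.n₁ + L.n₂) with hr₂ | hr₂
  · simp only [if_neg (not_lt.mpr hr₁), if_pos hr₂, dif_pos hr₂, cond_false, cond_true]
    refine congrArg (fun b => (rest, ok && b)) (Bool.eq_iff_iff.mpr ?_)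
    rw [decide_eq_true_iff, L.rhs_of_max x hr₁ hr₂, sup'_eq_iff]
    simp only [← (hX _).le_iff (hX _)]
    exact checkExtremum_iff (fun f g => g.le f) _ X (X r)
  · simp only [if_neg (not_lt.mpr hr₁), if_neg (not_lt.mpr hr₂), dif_neg (not_lt.mpr hr₂),
      cond_true, List.append_assoc]
    refine congrArg₂ (fun l b => (l, ok && b)) ?_ (Bool.eq_iff_iff.mpr ?_)
    · exact congrArg List.tail
        (List.drop_left' ((List.length_map _).trans (List.length_map _).symm))
    · rw [decide_eq_true_iff, L.rhs_of_affine x hr₂]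
      exact checkAffine_iff hX _ _ rest r

theorem foldl_checkStep (hX : ∀ l, (X l).Represents (x l)) (l : List (Fin L.n)) (ok : Bool) :
    ((l.map fun r : Fin L.n => (kind L.n₁ L.n₂ r, X r)).foldl
      (checkStep ((List.finRange L.n).map X)) (l.flatMap L.rowBlocks, ok)).2 = true ↔
      ok = true ∧ ∀ r ∈ l, L.rhs x r = x r := by
  induction l generalizing ok with
  | nil => simp
  | cons r l ih =>
    rw [List.map_cons, List.foldl_cons, List.flatMap_cons, checkStep_rowBlocks hX, ih,
      Bool.and_eq_true, decide_eq_true_iff, List.forall_mem_cons, and_assoc]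

theorem checkRows_iff (hX : ∀ l, (X l).Represents (x l)) :
    checkRows (kinds (LEMMInstance.unaryBlock L.n₁) (LEMMInstance.unaryBlock L.n₂)
      (LEMMInstance.unaryBlock L.n)) ((List.finRange L.n).flatMap L.rowBlocks)
      ((List.finRange L.n).map X) = true ↔ L.rhs x = x := by
  rw [checkRows, kinds_zip (LEMMInstance.length_unaryBlock _),
    LEMMInstance.length_unaryBlock, LEMMInstance.length_unaryBlock, foldl_checkStep hX, funext_iff]
  simp only [List.mem_finRange, true_imp_iff, true_and]

end LEMM

/-- The certificate of a vector. -/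
noncomputable def certificate {n : ℕ} (x : Fin n → ℚ) : List Cell :=
  writeCert ((List.finRange n).map fun r => CertNumber.ofRat (x r))

theorem checkCert_iff {n : ℕ} {l : List Cell} (hl : l.length = n) (w : List Cell) :
    checkCert l w = true ↔ ∃ x : Fin n → ℚ, w = certificate x := by
  simp only [checkCert, Bool.and_eq_true, decide_eq_true_eq, List.all_eq_true, hl]
  constructor
  · rintro ⟨hw, hcanonical, hlen⟩
    subst hlen
    refine ⟨fun r => (readCert w)[r].1.val, hw.symm.trans (congrArg writeCert ?_)⟩
    refine (List.map_getElem_finRange (readCert w)).symm.trans (List.map_congr_left fun r _ => ?_)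
    exact (CertNumber.ofRat_val (hcanonical _ (List.getElem_mem r.2))).symm
  · rintro ⟨x, rfl⟩
    rw [certificate, readCert_writeCert]
    refine ⟨rfl, List.forall_mem_map.mpr fun r _ => CertNumber.canonical_ofRat _, ?_⟩
    rw [List.length_map, List.length_finRange]

theorem verify_iff (neg : Bool) (I : LEMMInstance) (w : List LEMMSymbol) :
    verify neg (lemmHaltingProblem.encodePair (I, w)) = true ↔
      ∃ x : Fin I.L.n → ℚ, w.map some = certificate x ∧ I.L.rhs x = x ∧
        (neg = true ↔ ¬ x I.i < I.β) := by
  rw [I.verify_encodePair]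
  simp only [verifyBlocks, LEMMInstance.blocks, List.headD_cons, List.tail_cons, Bool.and_eq_true]
  rw [checkCert_iff (LEMMInstance.length_unaryBlock _), ← exists_and_right]
  refine exists_congr fun x => and_congr_right fun hw => ?_
  have hX : (readCert (w.map some)).map Prod.fst =
      (List.finRange I.L.n).map fun r => (CertNumber.ofRat (x r)).1 := by
    rw [hw, certificate, readCert_writeCert, List.map_map]
    rfl
  have hrep (r : Fin I.L.n) := CertNumber.represents_ofRat (x r)
  rw [hX, LEMM.checkRows_iff hrep, checkThreshold_iff neg hrep]

/-! ### Existence and uniqueness of the solution -/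

section

variable {m n : Type*} [Fintype m] [Fintype n] {𝒬 : Set (Matrix m n ℝ)}

theorem exists_norm_mulVec_le (h𝒬 : IsCompact 𝒬) :
    ∃ M : ℝ, ∀ Q ∈ 𝒬, ∀ v, ‖Q.mulVec v‖ ≤ M * ‖v‖ := by
  classical
  let T : Matrix m n ℝ →ₗ[ℝ] (n → ℝ) →L[ℝ] (m → ℝ) :=
    (Matrix.toLin'.trans LinearMap.toContinuousLinearMap).toLinearMap
  obtain ⟨M, hM⟩ :=
    h𝒬.exists_bound_of_continuousOn T.continuous_of_finiteDimensional.continuousOn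
  exact ⟨M, fun Q hQ v => (T Q).le_of_opNorm_le (hM Q hQ) v⟩

theorem exists_pos_mul_norm_le_norm_mulVec (h𝒬 : IsCompact 𝒬)
    (hker : ∀ Q ∈ 𝒬, ∀ v, Q.mulVec v = 0 → v = 0) :
    ∃ c > 0, ∀ Q ∈ 𝒬, ∀ v, c * ‖v‖ ≤ ‖Q.mulVec v‖ := by
  have hcont : Continuous fun p : Matrix m n ℝ × (n → ℝ) => ‖p.1.mulVec p.2‖ := by fun_prop
  obtain ⟨c, hc, hsphere⟩ : ∃ c > 0, ∀ p ∈ 𝒬 ×ˢ Metric.sphere (0 : n → ℝ) 1,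
      c ≤ ‖p.1.mulVec p.2‖ :=
    (h𝒬.prod (isCompact_sphere 0 1)).exists_forall_le' hcont.continuousOn fun p hp =>
      norm_pos_iff.mpr fun h0 =>
        ne_zero_of_mem_unit_sphere ⟨p.2, hp.2⟩ (hker p.1 hp.1 p.2 h0)
  refine ⟨c, hc, fun Q hQ v => ?_⟩
  rcases eq_or_ne v 0 with rfl | hv
  · rw [norm_zero, mul_zero]
    exact norm_nonneg _
  have hunit : ‖‖v‖⁻¹ • v‖ = 1 := norm_smul_inv_norm hv
  have h := hsphere (Q, ‖v‖⁻¹ • v) ⟨hQ, mem_sphere_zero_iff_norm.mpr hunit⟩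
  rwa [Matrix.mulVec_smul, norm_smul, norm_inv, norm_norm,
    le_inv_mul_iff₀ (norm_pos_iff.mpr hv), mul_comm] at h

end

section

open scoped NNReal

variable {E : Type*} [NormedAddCommGroup E] [NormedSpace ℝ E] [CompleteSpace E] {F : E → E}
  {M K : ℝ≥0}

theorem surjective_sub_add_smul (hF : LipschitzWith M F) {t s : ℝ}
    (hanti : AntilipschitzWith K fun x => x - t • F x)
    (hsurj : Function.Surjective fun x => x - t • F x) (hs : K * (‖s‖₊ * M) < 1) :
    Function.Surjective fun x => x - (t + s) • F x := by
  intro a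
  obtain ⟨S, hS⟩ := hsurj.hasRightInverse
  have hcontr : ContractingWith (K * (‖s‖₊ * M + 0)) fun x => S (s • F x + a) :=
    ⟨by rwa [add_zero], (hanti.to_rightInverse hS).comp
      (((lipschitzWith_smul s).comp hF).add (LipschitzWith.const a))⟩
  obtain ⟨x, hx⟩ : ∃ x, S (s • F x + a) = x := ⟨_, hcontr.fixedPoint_isFixedPt⟩
  refine ⟨x, ?_⟩
  have hsub := hS (s • F x + a)
  simp only [hx] at hsub
  simp only [add_smul]
  rw [← sub_sub, hsub, add_sub_cancel_left]

/-- The continuity method: the equation `x - t • F x = a` is solvable for `t = 0`, and solvability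
extends from `t` to `t + s` for all `s` below a uniform bound. -/
theorem surjective_sub_of_antilipschitzWith (hF : LipschitzWith M F)
    (hanti : ∀ t ∈ Set.Icc (0 : ℝ) 1, AntilipschitzWith K fun x => x - t • F x) :
    Function.Surjective fun x => x - F x := by
  obtain ⟨N, hN⟩ := exists_nat_gt (K * M)
  have hN₀ : (0 : ℝ≥0) < N := (zero_le).trans_lt hN
  have hN₀' : (0 : ℝ) < N := NNReal.coe_pos.mpr hN₀
  have hsurj (k : ℕ) (hk : k ≤ N) : Function.Surjective fun x => x - ((k : ℝ) / N) • F x := by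
    induction k with
    | zero => exact fun a => ⟨a, by simp⟩
    | succ k ih =>
      rw [Nat.cast_succ, add_div]
      have hmem : (k : ℝ) / N ∈ Set.Icc (0 : ℝ) 1 :=
        ⟨by positivity, (div_le_one hN₀').mpr (Nat.cast_le.mpr ((Nat.le_succ k).trans hk))⟩
      refine surjective_sub_add_smul hF (hanti _ hmem) (ih ((Nat.le_succ k).trans hk)) ?_
      have hnorm : ‖(1 / N : ℝ)‖₊ = 1 / N := by simp
      rwa [hnorm, mul_left_comm, one_div_mul_eq_div, div_lt_one hN₀]
  have h := hsurj N le_rfl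
  simpa only [div_self hN₀'.ne', one_smul] using h

theorem existsUnique_fixedPoint_of_antilipschitzWith (hF : LipschitzWith M F)
    (hanti : ∀ t ∈ Set.Icc (0 : ℝ) 1, AntilipschitzWith K fun x => x - t • F x) :
    ∃! x, F x = x := by
  obtain ⟨x, hx⟩ := surjective_sub_of_antilipschitzWith hF hanti 0
  have hinj := (hanti 1 ⟨zero_le_one, le_rfl⟩).injective
  simp only [one_smul] at hinj
  exact ⟨x, (sub_eq_zero.mp hx).symm, fun y hy => hinj ((sub_eq_zero.mpr hy.symm).trans hx.symm)⟩

end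

namespace LEMM

variable {L : LEMM ℝ} {Q : Matrix (Fin L.n) (Fin L.n) ℝ}

/-- The possible rows number `r` of the choice matrices. -/
def rowSet (L : LEMM ℝ) (r : Fin L.n) : Set (Fin L.n → ℝ) :=
  if h : (r : ℕ) < L.n₁ + L.n₂ then (fun l => Pi.single l 1) '' (L.J r h : Set (Fin L.n))
  else {L.q r (not_lt.mp h)}

theorem rowSet_of_lt {r : Fin L.n} (h : (r : ℕ) < L.n₁ + L.n₂) :
    L.rowSet r = (fun l => Pi.single l 1) '' (L.J r h : Set (Fin L.n)) :=
  dif_pos h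

theorem rowSet_of_le {r : Fin L.n} (h : L.n₁ + L.n₂ ≤ (r : ℕ)) : L.rowSet r = {L.q r h} :=
  dif_neg (not_lt.mpr h)

theorem choiceMatrix_of_lt (ℓ : ∀ i : Fin L.n, (i : ℕ) < L.n₁ + L.n₂ → Fin L.n) {r : Fin L.n}
    (h : (r : ℕ) < L.n₁ + L.n₂) : L.choiceMatrix ℓ r = Pi.single (ℓ r h) 1 := by
  funext l
  simp [choiceMatrix, h, Pi.single_apply]

theorem choiceMatrix_of_le (ℓ : ∀ i : Fin L.n, (i : ℕ) < L.n₁ + L.n₂ → Fin L.n) {r : Fin L.n}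
    (h : L.n₁ + L.n₂ ≤ (r : ℕ)) : L.choiceMatrix ℓ r = L.q r h := by
  funext l
  simp [choiceMatrix, not_lt.mpr h]

theorem choiceMatrices_eq_pi (L : LEMM ℝ) : L.choiceMatrices = Set.pi Set.univ L.rowSet := by
  ext Q
  constructor
  · rintro ⟨ℓ, hℓ, rfl⟩ r -
    rcases lt_or_ge (r : ℕ) (L.n₁ + L.n₂) with h | h
    · rw [rowSet_of_lt h, choiceMatrix_of_lt ℓ h]
      exact ⟨ℓ r h, hℓ r h, rfl⟩
    · rw [rowSet_of_le h, choiceMatrix_of_le ℓ h]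
      rfl
  · intro hQ
    have hrow (r : Fin L.n) (h : (r : ℕ) < L.n₁ + L.n₂) : ∃ l ∈ L.J r h, Pi.single l 1 = Q r :=
      (Set.ext_iff.mp (rowSet_of_lt h) (Q r)).mp (hQ r trivial)
    choose ℓ hℓ hQℓ using hrow
    refine ⟨ℓ, hℓ, funext fun r => ?_⟩
    rcases lt_or_ge (r : ℕ) (L.n₁ + L.n₂) with h | h
    · rw [choiceMatrix_of_lt ℓ h, hQℓ r h]
    · rw [choiceMatrix_of_le ℓ h]
      exact (Set.ext_iff.mp (rowSet_of_le h) (Q r)).mp (hQ r trivial)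

theorem isCompact_convexHull_choiceMatrices (L : LEMM ℝ) :
    IsCompact (convexHull ℝ L.choiceMatrices) := by
  refine Set.Finite.isCompact_convexHull ℝ ((Set.finite_range L.choiceMatrix).subset ?_)
  rintro Q ⟨ℓ, -, rfl⟩
  exact ⟨ℓ, rfl⟩

theorem exists_row_of_mem_uIcc {r : Fin L.n} (h : (r : ℕ) < L.n₁ + L.n₂) {l l' : Fin L.n}
    (hl : l ∈ L.J r h) (hl' : l' ∈ L.J r h) {v : Fin L.n → ℝ} {z : ℝ}
    (hz : z ∈ Set.uIcc (v l) (v l')) : ∃ w ∈ convexHull ℝ (L.rowSet r), z = w ⬝ᵥ v := by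
  have hmem {l : Fin L.n} (hl : l ∈ L.J r h) : Pi.single l 1 ∈ convexHull ℝ (L.rowSet r) :=
    subset_convexHull ℝ _ (rowSet_of_lt h ▸ ⟨l, hl, rfl⟩)
  rw [← segment_eq_uIcc] at hz
  obtain ⟨a, b, ha, hb, hab, rfl⟩ := hz
  refine ⟨_, convex_convexHull ℝ _ (hmem hl) (hmem hl') ha hb hab, ?_⟩
  rw [add_dotProduct, smul_dotProduct, smul_dotProduct, single_one_dotProduct,
    single_one_dotProduct]

theorem exists_row (L : LEMM ℝ) (x y : Fin L.n → ℝ) (r : Fin L.n) :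
    ∃ w ∈ convexHull ℝ (L.rowSet r), L.rhs x r - L.rhs y r = w ⬝ᵥ (x - y) := by
  rcases lt_or_ge (r : ℕ) L.n₁ with hr₁ | hr₁
  · rw [L.rhs_of_min x hr₁, L.rhs_of_min y hr₁]
    set s := L.J r (Nat.lt_add_right L.n₂ hr₁)
    have hs : s.Nonempty := L.J_nonempty r _
    obtain ⟨l, hl, hx⟩ := s.exists_mem_eq_inf' hs x
    obtain ⟨l', hl', hy⟩ := s.exists_mem_eq_inf' hs y
    refine exists_row_of_mem_uIcc _ hl hl' (Set.Icc_subset_uIcc ⟨?_, ?_⟩)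
    · exact (congrArg (· - y l) hx).ge.trans (sub_le_sub_left (s.inf'_le y hl) _)
    · exact (sub_le_sub_right (s.inf'_le x hl') _).trans (congrArg (x l' - ·) hy).le
  rcases lt_or_ge (r : ℕ) (L.n₁ + L.n₂) with hr₂ | hr₂
  · rw [L.rhs_of_max x hr₁ hr₂, L.rhs_of_max y hr₁ hr₂]
    set s := L.J r hr₂
    have hs : s.Nonempty := L.J_nonempty r _
    obtain ⟨l, hl, hx⟩ := s.exists_mem_eq_sup' hs x
    obtain ⟨l', hl', hy⟩ := s.exists_mem_eq_sup' hs y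
    refine exists_row_of_mem_uIcc _ hl' hl (Set.Icc_subset_uIcc ⟨?_, ?_⟩)
    · exact (congrArg (x l' - ·) hy).ge.trans (sub_le_sub_right (s.le_sup' x hl') _)
    · exact (sub_le_sub_left (s.le_sup' y hl) _).trans (congrArg (· - y l) hx).le
  · refine ⟨L.q r hr₂, subset_convexHull ℝ _ (rowSet_of_le hr₂ ▸ rfl), ?_⟩
    rw [L.rhs_of_affine x hr₂, L.rhs_of_affine y hr₂, add_sub_add_right_eq_sub, dotProduct_sub]
    rfl

theorem exists_mulVec (L : LEMM ℝ) (x y : Fin L.n → ℝ) :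
    ∃ Q ∈ convexHull ℝ L.choiceMatrices, L.rhs x - L.rhs y = Q.mulVec (x - y) := by
  choose w hw hrow using L.exists_row x y
  have hmem : w ∈ convexHull ℝ (Set.pi Set.univ L.rowSet) := by
    rw [convexHull_pi]
    exact fun r _ => hw r
  exact ⟨Matrix.of w, L.choiceMatrices_eq_pi ▸ hmem, funext hrow⟩

theorem exists_lipschitzWith_rhs (L : LEMM ℝ) : ∃ M, LipschitzWith M L.rhs := by
  obtain ⟨M, hM⟩ := exists_norm_mulVec_le L.isCompact_convexHull_choiceMatrices
  refine ⟨M.toNNReal, LipschitzWith.of_dist_le' fun x y => ?_⟩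
  obtain ⟨Q, hQ, hxy⟩ := L.exists_mulVec x y
  rw [dist_eq_norm, dist_eq_norm, hxy]
  exact hM Q hQ (x - y)

namespace Halting

theorem eq_zero_of_smul_mulVec_eq (hL : L.Halting) (hQ : Q ∈ convexHull ℝ L.choiceMatrices) {t : ℝ}
    (ht : t ∈ Set.Icc 0 1) {v : Fin L.n → ℝ} (hv : t • Q.mulVec v = v) : v = 0 := by
  have hpow (m : ℕ) : t ^ m • (Q ^ m).mulVec v = v := by
    induction m with
    | zero => simp
    | succ m ih =>
      rw [pow_succ', pow_succ', ← Matrix.mulVec_mulVec, mul_smul, ← Matrix.mulVec_smul, ih, hv]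
  have hcont : Continuous fun A : Matrix (Fin L.n) (Fin L.n) ℝ => A.mulVec v := by fun_prop
  have hlim : Tendsto (fun m : ℕ => (Q ^ m).mulVec v) atTop (𝓝 0) := by
    simpa [Function.comp_def] using (hcont.tendsto 0).comp (hL Q hQ)
  have hle (m : ℕ) : ‖v‖ ≤ ‖(Q ^ m).mulVec v‖ := by
    conv_lhs => rw [← hpow m, norm_smul, norm_pow, Real.norm_of_nonneg ht.1]
    exact mul_le_of_le_one_left (norm_nonneg _) (pow_le_one₀ ht.1 ht.2)
  exact norm_le_zero_iff.mp (ge_of_tendsto' (tendsto_zero_iff_norm_tendsto_zero.mp hlim) hle)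

theorem exists_antilipschitzWith (hL : L.Halting) :
    ∃ K, ∀ t ∈ Set.Icc (0 : ℝ) 1, AntilipschitzWith K fun x => x - t • L.rhs x := by
  have hcompact : IsCompact ((fun p : ℝ × Matrix (Fin L.n) (Fin L.n) ℝ => 1 - p.1 • p.2) ''
      Set.Icc 0 1 ×ˢ convexHull ℝ L.choiceMatrices) :=
    (isCompact_Icc.prod L.isCompact_convexHull_choiceMatrices).image (by fun_prop)
  have hmulVec (t : ℝ) (Q : Matrix (Fin L.n) (Fin L.n) ℝ) (v : Fin L.n → ℝ) :
      (1 - t • Q).mulVec v = v - t • Q.mulVec v := by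
    rw [Matrix.sub_mulVec, Matrix.one_mulVec, Matrix.smul_mulVec]
  obtain ⟨c, hc, hbound⟩ := exists_pos_mul_norm_le_norm_mulVec hcompact (by
    rintro _ ⟨⟨t, Q⟩, ⟨ht, hQ⟩, rfl⟩ v hv
    rw [hmulVec, sub_eq_zero] at hv
    exact hL.eq_zero_of_smul_mulVec_eq hQ ht hv.symm)
  refine ⟨c⁻¹.toNNReal, fun t ht => AntilipschitzWith.of_le_mul_dist fun x y => ?_⟩
  obtain ⟨Q, hQ, hxy⟩ := L.exists_mulVec x y
  have h := hbound _ ⟨(t, Q), ⟨ht, hQ⟩, rfl⟩ (x - y)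
  rw [hmulVec, ← hxy] at h
  rw [Real.coe_toNNReal _ (inv_nonneg.mpr hc.le), dist_eq_norm, dist_eq_norm, le_inv_mul_iff₀ hc]
  refine h.trans_eq (congrArg norm ?_)
  rw [smul_sub]
  abel

theorem existsUnique_isFeasible (hL : L.Halting) : ∃! x, L.IsFeasible x := by
  obtain ⟨M, hM⟩ := L.exists_lipschitzWith_rhs
  obtain ⟨K, hK⟩ := hL.exists_antilipschitzWith
  simp only [isFeasible_iff_rhs_eq]
  exact existsUnique_fixedPoint_of_antilipschitzWith hM hK

end Halting

end LEMM

/-! ### The number of digits of the solution -/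

section

variable {ι : Type*} [Fintype ι] [DecidableEq ι]

theorem natAbs_det_le {Z : Matrix ι ι ℤ} {B : ℕ} (hZ : ∀ i j, (Z i j).natAbs ≤ B) :
    Z.det.natAbs ≤ (Fintype.card ι).factorial * B ^ Fintype.card ι := by
  have h := Matrix.det_le (A := Z) (abv := AbsoluteValue.abs) (x := (B : ℤ)) fun i j => by
    rw [AbsoluteValue.abs_apply, Int.abs_eq_natAbs]
    exact_mod_cast hZ i j
  rw [AbsoluteValue.abs_apply, nsmul_eq_mul, Int.abs_eq_natAbs] at h
  exact_mod_cast h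

theorem det_smul_eq_cramer {R : Type*} [CommRing R] {A : Matrix ι ι R} {a x : ι → R}
    (h : A.mulVec x = a) : A.det • x = A.cramer a := by
  rw [← h, Matrix.cramer_eq_adjugate_mulVec, Matrix.mulVec_mulVec, Matrix.adjugate_mul,
    Matrix.smul_mulVec, Matrix.one_mulVec]

theorem natAbs_num_divInt_le (a : ℤ) {b : ℤ} (hb : b ≠ 0) :
    (Rat.divInt a b).num.natAbs ≤ a.natAbs := by
  rcases eq_or_ne a 0 with rfl | ha
  · simp
  · exact Nat.le_of_dvd (Int.natAbs_pos.mpr ha) (Int.natAbs_dvd_natAbs.mpr (Rat.num_dvd a hb))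

theorem den_divInt_le (a : ℤ) {b : ℤ} (hb : b ≠ 0) : (Rat.divInt a b).den ≤ b.natAbs :=
  Nat.le_of_dvd (Int.natAbs_pos.mpr hb) (Int.natCast_dvd.mp (Rat.den_dvd a b))

theorem num_den_le_of_intCast_mulVec_eq {Z : Matrix ι ι ℤ} {z : ι → ℤ} {x : ι → ℚ} {B : ℕ}
    (hZ : ∀ i j, (Z i j).natAbs ≤ B) (hz : ∀ i, (z i).natAbs ≤ B) (hdet : Z.det ≠ 0)
    (hx : (Z.map (Int.cast : ℤ → ℚ)).mulVec x = fun i => (z i : ℚ)) (j : ι) :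
    (x j).num.natAbs ≤ (Fintype.card ι).factorial * B ^ Fintype.card ι ∧
      (x j).den ≤ (Fintype.card ι).factorial * B ^ Fintype.card ι := by
  have hcramer : (Z.det : ℚ) * x j = ((Z.updateCol j z).det : ℚ) := by
    have h := congrFun (det_smul_eq_cramer hx) j
    rw [Pi.smul_apply, smul_eq_mul, Matrix.cramer_apply] at h
    rw [Int.cast_det, h, Int.cast_det, Matrix.map_updateCol]
    rfl
  have hxj : x j = Rat.divInt (Z.updateCol j z).det Z.det := by
    rw [Rat.divInt_eq_div, ← hcramer, mul_div_cancel_left₀ _ (Int.cast_ne_zero.mpr hdet)]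
  have hupdate : ∀ i k, ((Z.updateCol j z) i k).natAbs ≤ B := fun i k => by
    rw [Matrix.updateCol_apply]
    split_ifs
    exacts [hz i, hZ i k]
  rw [hxj]
  exact ⟨(natAbs_num_divInt_le _ hdet).trans (natAbs_det_le hupdate),
    (den_divInt_le _ hdet).trans (natAbs_det_le hZ)⟩

theorem num_den_le_of_mulVec_eq {A : Matrix ι ι ℚ} {a x : ι → ℚ} (hdet : A.det ≠ 0)
    (hx : A.mulVec x = a) {D : ι → ℕ} (hD : ∀ i, D i ≠ 0) {B : ℕ}
    (hA : ∀ i j, ∃ z : ℤ, (z : ℚ) = D i * A i j ∧ z.natAbs ≤ B)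
    (ha : ∀ i, ∃ z : ℤ, (z : ℚ) = D i * a i ∧ z.natAbs ≤ B) (j : ι) :
    (x j).num.natAbs ≤ (Fintype.card ι).factorial * B ^ Fintype.card ι ∧
      (x j).den ≤ (Fintype.card ι).factorial * B ^ Fintype.card ι := by
  choose Z hZ hZB using hA
  choose z hz hzB using ha
  have hmap : Matrix.map (Matrix.of Z) (Int.cast : ℤ → ℚ) = Matrix.of fun i j => D i * A i j :=
    Matrix.ext hZ
  refine num_den_le_of_intCast_mulVec_eq (Z := Matrix.of Z) hZB hzB ?_ ?_ j
  · rw [← Int.cast_ne_zero (α := ℚ), Int.cast_det, hmap, Matrix.det_mul_column]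
    exact mul_ne_zero (Finset.prod_ne_zero_iff.mpr fun i _ => Nat.cast_ne_zero.mpr (hD i)) hdet
  · funext i
    rw [hmap, hz, ← hx]
    simp only [Matrix.mulVec, dotProduct, Matrix.of_apply, mul_assoc, Finset.mul_sum]

theorem exists_rat_mulVec_eq {K : Type*} [Field K] [CharZero K] {A : Matrix ι ι ℚ}
    (hdet : A.det ≠ 0) {a : ι → ℚ} {x : ι → K}
    (hx : (A.map (Rat.cast : ℚ → K)).mulVec x = fun i => (a i : K)) :
    ∃ y : ι → ℚ, A.mulVec y = a ∧ x = fun i => (y i : K) := by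
  have hunit : IsUnit (A.map (Rat.cast : ℚ → K)) :=
    ((A.isUnit_iff_isUnit_det).mpr hdet.isUnit).map (Rat.castHom K).mapMatrix
  have hA : A.mulVec (A⁻¹.mulVec a) = a := by
    rw [Matrix.mulVec_mulVec, A.mul_nonsing_inv hdet.isUnit, Matrix.one_mulVec]
  refine ⟨A⁻¹.mulVec a, hA, Matrix.mulVec_injective_of_isUnit hunit (hx.trans ?_)⟩
  funext i
  exact (congrArg Rat.cast (congrFun hA i).symm).trans ((Rat.castHom K).map_mulVec A _ i)

end

namespace LEMMInstance

theorem size_add_size_le_length_encodeRat (r : ℚ) :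
    r.num.natAbs.size + r.den.size ≤ (encodeRat r).length := by
  simp only [encodeRat, List.length_append, List.length_map, ← Nat.size_eq_bits_len]
  lia

theorem natAbs_num_le_two_pow_of_length_encodeRat_le {r : ℚ} {N : ℕ}
    (h : (encodeRat r).length ≤ N) : r.num.natAbs ≤ 2 ^ N :=
  (Nat.size_le.mp (by have := size_add_size_le_length_encodeRat r; lia)).le

theorem den_le_two_pow_of_length_encodeRat_le {r : ℚ} {N : ℕ} (h : (encodeRat r).length ≤ N) :
    r.den ≤ 2 ^ N :=
  (Nat.size_le.mp (by have := size_add_size_le_length_encodeRat r; lia)).le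

theorem length_encodeRow_le (I : LEMMInstance) (r : Fin I.L.n) :
    (encodeRow I.L r).length ≤ I.encode.length := by
  have h : (encodeRow I.L r).length ≤ ((List.finRange I.L.n).flatMap (encodeRow I.L)).length := by
    rw [List.length_flatMap]
    exact List.le_sum_of_mem (List.mem_map_of_mem (List.mem_finRange r))
  simp only [encode, List.length_append]
  lia

theorem n_le_length_encode (I : LEMMInstance) : I.L.n ≤ I.encode.length := by
  simp only [encode, encodeUnary, List.length_append, List.length_replicate]
  lia

end LEMMInstance

theorem exists_common_denominator {ι : Type*} [Fintype ι] (f : ι → ℚ) {N : ℕ}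
    (hN : ∑ j, (LEMMInstance.encodeRat (f j)).length ≤ N) :
    ∃ D : ℕ, D ≠ 0 ∧ D ≤ 2 ^ N ∧ ∀ j, (f j).den ∣ D ∧ (f j).num.natAbs ≤ 2 ^ N := by
  refine ⟨∏ j, (f j).den, Finset.prod_ne_zero_iff.mpr fun j _ => (f j).den_ne_zero, ?_,
    fun j => ⟨Finset.dvd_prod_of_mem _ (Finset.mem_univ j), ?_⟩⟩
  · refine le_trans ?_ (Nat.pow_le_pow_right two_pos hN)
    rw [← Finset.prod_pow_eq_pow_sum]
    exact Finset.prod_le_prod' fun j _ => LEMMInstance.den_le_two_pow_of_length_encodeRat_le le_rfl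
  · exact LEMMInstance.natAbs_num_le_two_pow_of_length_encodeRat_le
      ((Finset.single_le_sum_of_canonicallyOrdered (Finset.mem_univ j)).trans hN)

theorem exists_int_eq_mul {q : ℚ} {D : ℕ} (h : q.den ∣ D) :
    ∃ z : ℤ, (z : ℚ) = D * q ∧ z.natAbs ≤ D * q.num.natAbs := by
  obtain ⟨k, rfl⟩ := h
  refine ⟨k * q.num, ?_, ?_⟩
  · push_cast
    rw [mul_right_comm, Rat.den_mul_eq_num, mul_comm]
  · rw [Int.natAbs_mul, Int.natAbs_natCast]
    exact Nat.mul_le_mul_right _ (Nat.le_mul_of_pos_left k q.den_pos)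

namespace LEMM

/-- The constant terms of the equations. -/
def constant {R : Type} [Zero R] (L : LEMM R) (i : Fin L.n) : R :=
  if h : (i : ℕ) < L.n₁ + L.n₂ then 0 else L.b i (not_lt.mp h)

theorem exists_rhs_eq (L : LEMM ℝ) (x : Fin L.n → ℝ) :
    ∃ ℓ : ∀ i : Fin L.n, (i : ℕ) < L.n₁ + L.n₂ → Fin L.n, (∀ i h, ℓ i h ∈ L.J i h) ∧
      L.rhs x = (L.choiceMatrix ℓ).mulVec x + L.constant := by
  have hchoice (i : Fin L.n) (h : (i : ℕ) < L.n₁ + L.n₂) : ∃ l ∈ L.J i h, L.rhs x i = x l := by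
    rcases lt_or_ge (i : ℕ) L.n₁ with hi | hi
    · rw [rhs_of_min L x hi]
      exact (L.J i h).exists_mem_eq_inf' (L.J_nonempty i h) x
    · rw [rhs_of_max L x hi h]
      exact (L.J i h).exists_mem_eq_sup' (L.J_nonempty i h) x
  choose ℓ hℓ hrhs using hchoice
  refine ⟨ℓ, hℓ, funext fun i => ?_⟩
  rw [Pi.add_apply, Matrix.mulVec, constant]
  split_ifs with h
  · rw [choiceMatrix_of_lt ℓ h, single_one_dotProduct, hrhs i h, add_zero]
  · rw [choiceMatrix_of_le ℓ (not_lt.mp h), rhs_of_affine L x (not_lt.mp h), dotProduct]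

/-- The rational form of the matrix `choiceMatrix`. -/
def ratChoiceMatrix (L : LEMM ℚ) (ℓ : ∀ i : Fin L.n, (i : ℕ) < L.n₁ + L.n₂ → Fin L.n) :
    Matrix (Fin L.n) (Fin L.n) ℚ :=
  Matrix.of fun i j =>
    if h : (i : ℕ) < L.n₁ + L.n₂ then (if j = ℓ i h then 1 else 0) else L.q i (not_lt.mp h) j

variable {L : LEMM ℚ} (ℓ : ∀ i : Fin L.n, (i : ℕ) < L.n₁ + L.n₂ → Fin L.n)

theorem choiceMatrix_toReal :
    L.toReal.choiceMatrix ℓ = (L.ratChoiceMatrix ℓ).map (Rat.cast : ℚ → ℝ) := by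
  refine Matrix.ext fun (i j : Fin L.n) => ?_
  rw [Matrix.map_apply, ratChoiceMatrix, Matrix.of_apply]
  by_cases h : (i : ℕ) < L.n₁ + L.n₂
  · rw [dif_pos h, apply_ite Rat.cast, Rat.cast_one, Rat.cast_zero]
    exact dif_pos h
  · rw [dif_neg h]
    exact dif_neg h

theorem constant_toReal (i : Fin L.n) : L.toReal.constant i = L.constant i := by
  by_cases h : (i : ℕ) < L.n₁ + L.n₂
  · rw [constant, dif_pos h, Rat.cast_zero]
    exact dif_pos h
  · rw [constant, dif_neg h]
    exact dif_neg h

theorem exists_row_denominator {i : Fin L.n} {N : ℕ}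
    (hN : (LEMMInstance.encodeRow L i).length ≤ N) :
    ∃ D : ℕ, D ≠ 0 ∧ D ≤ 2 ^ N ∧
      (∀ j, (L.ratChoiceMatrix ℓ i j).den ∣ D ∧ (L.ratChoiceMatrix ℓ i j).num.natAbs ≤ 2 ^ N) ∧
      (L.constant i).den ∣ D ∧ (L.constant i).num.natAbs ≤ 2 ^ N := by
  by_cases h : (i : ℕ) < L.n₁ + L.n₂
  · refine ⟨1, one_ne_zero, Nat.one_le_two_pow, fun j => ?_, ?_⟩
    · rw [ratChoiceMatrix, Matrix.of_apply, dif_pos h]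
      split_ifs <;> simp [Nat.one_le_two_pow]
    · simp [constant, h]
  · have hq (j : Fin L.n) : L.ratChoiceMatrix ℓ i j = L.q i (not_lt.mp h) j := dif_neg h
    have hb : L.constant i = L.b i (not_lt.mp h) := dif_neg h
    rw [LEMMInstance.encodeRow, dif_neg h, List.length_append, List.length_flatMap,
      ← Fin.sum_univ_def] at hN
    obtain ⟨D, hD, hDN, hrow⟩ := exists_common_denominator (N := N)
      (fun o : Option (Fin L.n) => o.elim (L.b i (not_lt.mp h)) (L.q i (not_lt.mp h)))
      (by rw [Fintype.sum_option, add_comm]; exact hN)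
    exact ⟨D, hD, hDN, fun j => hq j ▸ hrow (some j), hb ▸ hrow none⟩

theorem Halting.det_one_sub_ratChoiceMatrix_ne_zero (hL : L.toReal.Halting)
    (hℓ : ∀ i h, ℓ i h ∈ L.J i h) : (1 - L.ratChoiceMatrix ℓ).det ≠ 0 := by
  refine fun hdet => ?_
  obtain ⟨v, hv, hmul⟩ := Matrix.exists_mulVec_eq_zero_iff.mpr hdet
  rw [Matrix.sub_mulVec, Matrix.one_mulVec, sub_eq_zero] at hmul
  have hreal : (L.toReal.choiceMatrix ℓ).mulVec (fun j => (v j : ℝ)) = fun j => (v j : ℝ) := by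
    rw [choiceMatrix_toReal]
    funext i
    exact ((Rat.castHom ℝ).map_mulVec _ v i).symm.trans (congrArg Rat.cast (congrFun hmul i).symm)
  have hzero := hL.eq_zero_of_smul_mulVec_eq (subset_convexHull ℝ _ ⟨ℓ, hℓ, rfl⟩)
    (Set.right_mem_Icc.mpr zero_le_one) ((one_smul ℝ _).trans hreal)
  exact hv (funext fun j => Rat.cast_eq_zero.mp (congrFun hzero j))

theorem exists_row_scaling {i : Fin L.n} {N : ℕ}
    (hN : (LEMMInstance.encodeRow L i).length ≤ N) :
    ∃ D : ℕ, D ≠ 0 ∧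
      (∀ j, ∃ z : ℤ, (z : ℚ) = D * (1 - L.ratChoiceMatrix ℓ) i j ∧ z.natAbs ≤ 2 ^ (2 * N + 1)) ∧
      ∃ z : ℤ, (z : ℚ) = D * L.constant i ∧ z.natAbs ≤ 2 ^ (2 * N + 1) := by
  obtain ⟨D, hD, hDN, hrow, hden, hnum⟩ := exists_row_denominator ℓ hN
  have hmul {m : ℕ} (hm : m ≤ 2 ^ N) : D * m ≤ 2 ^ N * 2 ^ N := Nat.mul_le_mul hDN hm
  have hpow : 2 ^ (2 * N + 1) = 2 * (2 ^ N * 2 ^ N) := by ring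
  have hone : 2 ^ N ≤ 2 ^ N * 2 ^ N := Nat.le_mul_of_pos_left _ (by positivity)
  refine ⟨D, hD, fun j => ?_, ?_⟩
  · obtain ⟨z, hz, hzle⟩ := exists_int_eq_mul (hrow j).1
    have hz' := hzle.trans (hmul (hrow j).2)
    rw [Matrix.sub_apply, Matrix.one_apply, mul_sub, ← hz]
    split_ifs
    · exact ⟨D - z, by push_cast; rw [mul_one], by lia⟩
    · exact ⟨-z, by push_cast; rw [mul_zero, zero_sub], by lia⟩
  · obtain ⟨z, hz, hzle⟩ := exists_int_eq_mul hden
    exact ⟨z, hz, (hzle.trans (hmul hnum)).trans (by lia)⟩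

theorem exists_one_sub_ratChoiceMatrix_mulVec_eq {x : Fin L.n → ℝ} (hx : L.toReal.IsFeasible x) :
    ∃ ℓ : ∀ i : Fin L.n, (i : ℕ) < L.n₁ + L.n₂ → Fin L.n, (∀ i h, ℓ i h ∈ L.J i h) ∧
      ((1 - L.ratChoiceMatrix ℓ).map (Rat.cast : ℚ → ℝ)).mulVec x =
        fun i => (L.constant i : ℝ) := by
  obtain ⟨ℓ, hℓ, hrhs⟩ : ∃ ℓ : ∀ i : Fin L.n, (i : ℕ) < L.n₁ + L.n₂ → Fin L.n,
      (∀ i h, ℓ i h ∈ L.J i h) ∧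
        L.toReal.rhs x = (L.toReal.choiceMatrix ℓ).mulVec x + L.toReal.constant :=
    L.toReal.exists_rhs_eq x
  refine ⟨ℓ, hℓ, ?_⟩
  rw [Matrix.map_sub _ Rat.cast_sub, Matrix.map_one _ Rat.cast_zero Rat.cast_one,
    Matrix.sub_mulVec, Matrix.one_mulVec, sub_eq_iff_eq_add']
  refine ((isFeasible_iff_rhs_eq _ _).mp hx).symm.trans (hrhs.trans ?_)
  exact congrArg₂ (fun Q c => Matrix.mulVec Q x + c) (choiceMatrix_toReal ℓ)
    (funext constant_toReal)

theorem Halting.exists_rat_rhs_eq (hL : L.toReal.Halting) {N : ℕ}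
    (hN : ∀ i, (LEMMInstance.encodeRow L i).length ≤ N) :
    ∃ x : Fin L.n → ℚ, L.rhs x = x ∧
      ∀ j, (x j).num.natAbs ≤ L.n.factorial * (2 ^ (2 * N + 1)) ^ L.n ∧
        (x j).den ≤ L.n.factorial * (2 ^ (2 * N + 1)) ^ L.n := by
  obtain ⟨x, hx, -⟩ := hL.existsUnique_isFeasible
  obtain ⟨ℓ, hℓ, hreal⟩ := exists_one_sub_ratChoiceMatrix_mulVec_eq hx
  have hdet := hL.det_one_sub_ratChoiceMatrix_ne_zero ℓ hℓ
  obtain ⟨y, hy, rfl⟩ := exists_rat_mulVec_eq hdet hreal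
  choose D hD hrow hconst using fun i => exists_row_scaling ℓ (hN i)
  refine ⟨y, (isFeasible_toReal_iff L y).mp hx, ?_⟩
  simpa only [Fintype.card_fin] using num_den_le_of_mulVec_eq hdet hy hD hrow hconst

end LEMM

theorem factorial_mul_pow_le {n N : ℕ} (h : n ≤ N) :
    n.factorial * (2 ^ (2 * N + 1)) ^ n ≤ 2 ^ (3 * N ^ 2 + N) := by
  have hfactorial : n.factorial ≤ (2 ^ N) ^ N :=
    calc n.factorial ≤ n ^ n := n.factorial_le_pow
      _ ≤ (2 ^ N) ^ n := Nat.pow_le_pow_left (h.trans Nat.lt_two_pow_self.le) n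
      _ ≤ (2 ^ N) ^ N := Nat.pow_le_pow_right (by positivity) h
  calc n.factorial * (2 ^ (2 * N + 1)) ^ n ≤ (2 ^ N) ^ N * (2 ^ (2 * N + 1)) ^ N :=
        Nat.mul_le_mul hfactorial (Nat.pow_le_pow_right (by positivity) h)
    _ = 2 ^ (3 * N ^ 2 + N) := by ring

theorem LEMM.Halting.exists_forall_rhs_eq_iff {L : LEMM ℚ} (hL : L.toReal.Halting) {N : ℕ}
    (hn : L.n ≤ N) (hN : ∀ i, (LEMMInstance.encodeRow L i).length ≤ N) :
    ∃ x : Fin L.n → ℚ, (∀ y, L.rhs y = y ↔ y = x) ∧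
      ∀ j, (x j).num.natAbs ≤ 2 ^ (3 * N ^ 2 + N) ∧ (x j).den ≤ 2 ^ (3 * N ^ 2 + N) := by
  obtain ⟨x, hx, hsize⟩ := hL.exists_rat_rhs_eq hN
  refine ⟨x, fun y => ⟨fun hy => ?_, fun hy => hy ▸ hx⟩, fun j =>
    (hsize j).imp (·.trans (factorial_mul_pow_le hn)) (·.trans (factorial_mul_pow_le hn))⟩
  have hcast := hL.existsUnique_isFeasible.unique ((isFeasible_toReal_iff L y).mpr hy)
    ((isFeasible_toReal_iff L x).mpr hx)
  exact funext fun j => Rat.cast_injective (congrFun hcast j)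

theorem yes_iff {I : LEMMInstance} (hI : I.L.toReal.Halting) {x : Fin I.L.n → ℚ}
    (hx : I.L.rhs x = x) : lemmHaltingProblem.yes I ↔ x I.i < I.β := by
  have hfeasible := (LEMM.isFeasible_toReal_iff I.L x).mpr hx
  constructor
  · rintro ⟨y, hy, hlt⟩
    obtain rfl := hI.existsUnique_isFeasible.unique hy hfeasible
    exact Rat.cast_lt.mp hlt
  · exact fun hlt => ⟨_, hfeasible, Rat.cast_lt.mpr hlt⟩

namespace CertNumber

theorem length_write (t : CertNumber) : (write t).length =
    t.1.1.size + t.1.2.1.size + t.1.2.2.size + t.2.1.size + t.2.2.size + 5 := by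
  simp only [write, joinBlocks, bitString, List.map_cons, List.map_nil, List.flatMap_cons,
    List.flatMap_nil, List.length_append, List.length_map, List.length_cons, List.length_nil,
    Nat.size_eq_bits_len]
  lia

theorem length_write_ofRat_le {q : ℚ} {E : ℕ} (hnum : q.num.natAbs ≤ 2 ^ E)
    (hden : q.den ≤ 2 ^ E) : (write (ofRat q)).length ≤ 5 * (E + 2) + 5 := by
  obtain ⟨-, -, hp, hn, hd, hu, hv⟩ := (exists_canonical q).choose_spec
  have hsize (m : ℕ) (hm : m ≤ 2 ^ E + 1) : m.size ≤ E + 2 := Nat.size_le.mpr <| by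
    have hpow : 2 ^ (E + 2) = 4 * 2 ^ E := by ring
    have hpos : 0 < 2 ^ E := by positivity
    lia
  rw [length_write]
  have := hsize (ofRat q).1.1 (hp.trans (by lia))
  have := hsize (ofRat q).1.2.1 (hn.trans (by lia))
  have := hsize (ofRat q).1.2.2 (hd.le.trans (by lia))
  have := hsize (ofRat q).2.1 (hu.trans (by lia))
  have := hsize (ofRat q).2.2 (hv.trans (by lia))
  lia

end CertNumber

theorem length_certificate_le {n : ℕ} {x : Fin n → ℚ} {E : ℕ}
    (hx : ∀ j, (x j).num.natAbs ≤ 2 ^ E ∧ (x j).den ≤ 2 ^ E) :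
    (certificate x).length ≤ n * (5 * (E + 2) + 6) := by
  rw [certificate, writeCert, joinBlocks, List.length_flatMap]
  refine (List.sum_le_card_nsmul _ (5 * (E + 2) + 6) ?_).trans_eq (by simp)
  simp only [List.map_map, List.forall_mem_map, Function.comp_apply, List.length_append,
    List.length_singleton]
  exact fun j _ => Nat.succ_le_succ (CertNumber.length_write_ofRat_le (hx j).1 (hx j).2)

theorem exists_map_some_eq_certificate {n : ℕ} (x : Fin n → ℚ) :
    ∃ w : List LEMMSymbol, w.map some = certificate x := by
  refine (Set.ext_iff.mp (Set.range_list_map some) (certificate x)).mpr fun a ha => ?_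
  cases a with
  | some a => exact ⟨a, rfl⟩
  | none => simp [certificate, writeCert, CertNumber.write, joinBlocks, notMem_bitString] at ha

/-- A bound for the length of a certificate in terms of the length of the instance. -/
noncomputable def certificateBound : Polynomial ℕ := .X * (5 * (3 * .X ^ 2 + .X + 2) + 6)

theorem exists_certificate (I : LEMMInstance) (hI : I.L.toReal.Halting) :
    ∃ w : List LEMMSymbol, w.length ≤ certificateBound.eval I.encode.length ∧
      ∀ neg (w' : List LEMMSymbol),
        verify neg (lemmHaltingProblem.encodePair (I, w')) = true ↔
          w' = w ∧ (neg = true ↔ ¬ lemmHaltingProblem.yes I) := by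
  obtain ⟨x, hx, hsize⟩ :=
    hI.exists_forall_rhs_eq_iff I.n_le_length_encode I.length_encodeRow_le
  obtain ⟨w, hw⟩ := exists_map_some_eq_certificate x
  refine ⟨w, ?_, fun neg w' => ?_⟩
  · rw [← List.length_map some, hw]
    refine (length_certificate_le hsize).trans ?_
    exact (Nat.mul_le_mul_right _ I.n_le_length_encode).trans_eq (by simp [certificateBound])
  · refine (verify_iff neg I w').trans ?_
    simp only [yes_iff hI ((hx x).mpr rfl), hx,
      ← (List.map_injective_iff.mpr (Option.some_injective _)).eq_iff (a := w'), hw]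
    constructor
    · rintro ⟨_, hw', rfl, hlt⟩
      exact ⟨hw', hlt⟩
    · rintro ⟨hw', hlt⟩
      exact ⟨x, hw', rfl, hlt⟩

theorem lemmHaltingProblem_inUP : lemmHaltingProblem.InUP := by
  refine ⟨fun a => verify false (lemmHaltingProblem.encodePair a), certificateBound,
    (PolyTime.verify false).nonempty_tm2ComputableInPolyTime lemmHaltingProblem.encodePair,
    fun I hI => ?_⟩
  obtain ⟨w, hlen, hw⟩ := exists_certificate I hI
  refine ⟨fun hyes => ⟨w, hlen, fun w' => (hw false w').trans (and_iff_left (by simp [hyes]))⟩,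
    fun hno w' => Bool.eq_false_iff.mpr fun h => ?_⟩
  simpa [hno] using ((hw false w').mp h).2

theorem lemmHaltingProblem_inCoUP : lemmHaltingProblem.InCoUP := by
  refine ⟨fun a => verify true (lemmHaltingProblem.encodePair a), certificateBound,
    (PolyTime.verify true).nonempty_tm2ComputableInPolyTime lemmHaltingProblem.encodePair,
    fun I hI => ?_⟩
  obtain ⟨w, hlen, hw⟩ := exists_certificate I hI
  refine ⟨fun hno => ⟨w, hlen, fun w' => (hw true w').trans (and_iff_left (iff_of_true rfl hno))⟩,
    fun hyes w' => Bool.eq_false_iff.mpr fun h => ?_⟩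
  exact hyes (((hw true w').mp h).2.mp rfl)

theorem mainTheorem2 :
    (∀ L : LEMM ℝ, L.Halting → ∃! x : Fin L.n → ℝ, L.IsFeasible x) ∧
      lemmHaltingProblem.InUP ∧ lemmHaltingProblem.InCoUP :=
  ⟨fun _ hL => hL.existsUnique_isFeasible, lemmHaltingProblem_inUP, lemmHaltingProblem_inCoUP⟩
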